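/- Let $n\ge 1$ and $k\ge 3$ be integers, $\alpha\in(0,1)$, $B=\{(u,v)\in\mathbb R^2: u^2+v^2<1\}$, and let $X\in C^{k,\alpha}(\overline B,\mathbb R^{n+2})$ be a conformally parametrized immersion, i.e. $X_u,X_v$ are linearly independent, $X_u\cdot X_u=X_v\cdot X_v$ and $X_u\cdot X_v=0$ on $\overline B$. Write $u^1=u$, $u^2=v$, $g_{ij}=X_{u^i}\cdot X_{u^j}$, $(g^{ij})=(g_{ij})^{-1}$, $W=\sqrt{\det(g_{ij})}$. A \emph{normal frame} is a tuple $N=(N_1,\dots,N_n)\in C^{k-1,\alpha}(\overline B)$ of maps $N_\sigma\colon\overline B\to\mathbb R^{n+2}$ such that at each point of $\overline B$ the vectors $N_1,\dots,N_n$ are orthonormal, span the normal space $\{Z: X_u\cdot Z=X_v\cdot Z=0\}$ and satisfy $\det(X_u,X_v,N_1,\dots,N_n)>0$. A \emph{weak normal frame} is a tuple $N\in H^{1,2}(B)\cap L^\infty(B)$ with these three properties almost everywhere in $B$. Its \emph{torsion coefficients} are $T_{\sigma,i}^\vartheta=N_{\sigma,u^i}\cdot N_\vartheta$ (weak derivatives),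 and its \emph{total torsion} is $$\mathcal T(N)=\sum_{i,j=1}^2\sum_{\sigma,\vartheta=1}^n\iint_B g^{ij}\,T_{\sigma,i}^\vartheta\,T_{\sigma,j}^\vartheta\,W\,du\,dv.$$ For an $n\times n$ matrix function $R$ let $RN$ denote the tuple $(RN)_\sigma=\sum_{\vartheta}R_\sigma^\vartheta N_\vartheta$. A weak normal frame $N$ is a \emph{weak normal Coulomb frame} if for every skew-symmetric $A\in C^\infty(\overline B,\mathrm{so}(n))$ and every family $R(w,\varepsilon)\in C^\infty(\overline B\times(-\varepsilon_0,\varepsilon_0),SO(n))$, $\varepsilon_0>0$, with $R(\cdot,0)$ the unit matrix and $\partial_\varepsilon R(\cdot,0)=A$, the first variation vanishes: $$\lim_{\varepsilon\to0}\frac1\varepsilon\big\{\mathcal T(R(\cdot,\varepsilon)N)-\mathcal T(N)\big\}=0.$$ Then there is a weak normal Coulomb frame $N\in H^{1,2}(B)\cap L^\infty(B)$ that minimizes the total torsion among all weak normal frames of class $H^{1,2}(B)\cap L^\infty(B)$. Moreover, for every normal frame $\widetilde N\in C^{k-1,\alpha}(\overline B)$ there is a rotation $R\in H^{1,2}(B,SO(n))$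 with $N=R\widetilde N$ almost everywhere in $B$, and $R$ minimizes $Q\mapsto\mathcal T(Q\widetilde N)$ over $H^{1,2}(B,SO(n))$. -/

import Mathlib

open scoped ContDiff NNReal
open MeasureTheory

noncomputable section

namespace CoulombFrame

/-- Euclidean space `ℝ^m`. -/
abbrev E (m : ℕ) : Type := EuclideanSpace ℝ (Fin m)

/-- The open unit disc `B`. -/
def disc : Set (E 2) := Metric.ball 0 1

/-- The closed unit disc. -/
def closedDisc : Set (E 2) := Metric.closedBall 0 1

/-- The coordinate directions `e_0 = ∂_u`, `e_1 = ∂_v` of the parameter plane. -/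
def dir (i : Fin 2) : E 2 := EuclideanSpace.single i 1

/-- The class `C^{k,α}` on the closed disc: all derivatives up to order `k` exist and are
continuous up to the boundary, and those of order `k` are `α`-Hölder continuous. -/
def MemCHolder {F : Type*} [NormedAddCommGroup F] [NormedSpace ℝ F]
    (k : ℕ) (α : ℝ≥0) (f : E 2 → F) : Prop :=
  ContDiffOn ℝ k f closedDisc ∧
    ∃ C : ℝ≥0, HolderOnWith C α (iteratedFDerivWithin ℝ k f closedDisc) closedDisc

/-! ### Sobolev functions on the disc -/

section Sobolev

variable {F : Type*} [NormedAddCommGroup F] [NormedSpace ℝ F]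

/-- `g` is the weak partial derivative of `f` in the direction `e_i` on the disc `B`: both are
locally integrable on `B` and `∫_B (∂_i φ) f = - ∫_B φ g` for all `φ ∈ C_c^∞(B)`. -/
structure HasWeakPartial (i : Fin 2) (f g : E 2 → F) : Prop where
  locInt : LocallyIntegrableOn f disc volume
  locInt_deriv : LocallyIntegrableOn g disc volume
  integral_eq : ∀ φ : E 2 → ℝ, ContDiff ℝ ∞ φ → HasCompactSupport φ → tsupport φ ⊆ disc →
    ∫ w in disc, fderiv ℝ φ w (dir i) • f w = - ∫ w in disc, φ w • g w

open Classical in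
/-- The weak partial derivative of `f` on `B`, which is unique up to null sets
(and set to `0` if there is none). -/
def weakPartial (i : Fin 2) (f : E 2 → F) : E 2 → F :=
  if h : ∃ g, HasWeakPartial i f g then h.choose else 0

/-- The Sobolev class `H^{1,2}(B)`: `f` and its weak partial derivatives are in `L²(B)`. -/
def MemH12 (f : E 2 → F) : Prop :=
  MemLp f 2 (volume.restrict disc) ∧
    ∀ i : Fin 2, ∃ g, HasWeakPartial i f g ∧ MemLp g 2 (volume.restrict disc)

end Sobolev

/-! ### Surfaces -/

section Surface

variable {n : ℕ}

/-- The partial derivative `X_{u^i}` on the closed disc. -/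
def tangentVec (X : E 2 → E (n + 2)) (i : Fin 2) (w : E 2) : E (n + 2) :=
  fderivWithin ℝ X closedDisc w (dir i)

/-- `X` is an immersion of class `C^{k,α}` of the closed disc. -/
def IsImmersion (k : ℕ) (α : ℝ≥0) (X : E 2 → E (n + 2)) : Prop :=
  MemCHolder k α X ∧
    ∀ w ∈ closedDisc, LinearIndependent ℝ (fun i : Fin 2 => tangentVec X i w)

/-- The first fundamental form `g_{ij} = X_{u^i} · X_{u^j}`. -/
def firstForm (X : E 2 → E (n + 2)) (w : E 2) : Matrix (Fin 2) (Fin 2) ℝ :=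
  Matrix.of fun i j => inner ℝ (tangentVec X i w) (tangentVec X j w)

/-- The area element `W = √(det g)`. -/
def areaElement (X : E 2 → E (n + 2)) (w : E 2) : ℝ := Real.sqrt (firstForm X w).det

/-- `(u,v)` are conformal parameters of `X`: `g_{11} = g_{22}` and `g_{12} = 0`. -/
def IsConformal (X : E 2 → E (n + 2)) : Prop :=
  ∀ w ∈ closedDisc, firstForm X w 0 0 = firstForm X w 1 1 ∧ firstForm X w 0 1 = 0

/-- The normal space `{Z : X_u · Z = X_v · Z = 0}` at `w`. -/
def normalSpace (X : E 2 → E (n + 2)) (w : E 2) : Submodule ℝ (E (n + 2)) :=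
  (Submodule.span ℝ (Set.range fun i : Fin 2 => tangentVec X i w))ᗮ

/-- The determinant `det (X_u, X_v, N_1, …, N_n)` at `w`. -/
def orientationDet (X : E 2 → E (n + 2)) (w : E 2) (v : Fin n → E (n + 2)) : ℝ :=
  Matrix.det (Matrix.of fun a b : Fin (n + 2) =>
    (Matrix.vecCons (tangentVec X 0 w) (Matrix.vecCons (tangentVec X 1 w) v)) b a)

/-- `v_1, …, v_n` are orthonormal, span the normal space of `X` at `w`, and are positively
oriented. -/
structure IsNormalBasisAt (X : E 2 → E (n + 2)) (w : E 2) (v : Fin n → E (n + 2)) : Prop where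
  orthonormal : Orthonormal ℝ v
  span_eq : Submodule.span ℝ (Set.range v) = normalSpace X w
  oriented : 0 < orientationDet X w v

/-- A normal frame of class `C^{m,α}` on the closed disc. -/
def IsNormalFrame (m : ℕ) (α : ℝ≥0) (X : E 2 → E (n + 2)) (N : Fin n → E 2 → E (n + 2)) : Prop :=
  (∀ σ, MemCHolder m α (N σ)) ∧ ∀ w ∈ closedDisc, IsNormalBasisAt X w (fun σ => N σ w)

/-- A weak normal frame, of class `H^{1,2}(B) ∩ L^∞(B)`. -/
structure IsWeakNormalFrame (X : E 2 → E (n + 2)) (N : Fin n → E 2 → E (n + 2)) : Prop where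
  memH12 : ∀ σ, MemH12 (N σ)
  memLinfty : ∀ σ, MemLp (N σ) ⊤ (volume.restrict disc)
  ae_basis : ∀ᵐ w ∂(volume.restrict disc), IsNormalBasisAt X w (fun σ => N σ w)

/-- The torsion coefficients `T_{σ,i}^ϑ = N_{σ,u^i} · N_ϑ`, with weak derivatives. -/
def torsion (N : Fin n → E 2 → E (n + 2)) (σ ϑ : Fin n) (i : Fin 2) (w : E 2) : ℝ :=
  inner ℝ (weakPartial i (N σ) w) (N ϑ w)

/-- The total torsion `𝒯(N) = ∑_{i,j} ∑_{σ,ϑ} ∫_B g^{ij} T_{σ,i}^ϑ T_{σ,j}^ϑ W du dv`. -/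
def totalTorsion (X : E 2 → E (n + 2)) (N : Fin n → E 2 → E (n + 2)) : ℝ :=
  ∑ i : Fin 2, ∑ j : Fin 2, ∑ σ : Fin n, ∑ ϑ : Fin n,
    ∫ w in disc, (firstForm X w)⁻¹ i j * torsion N σ ϑ i w * torsion N σ ϑ j w * areaElement X w

/-! ### Rotations of frames and Coulomb frames -/

/-- The rotated frame `(R N)_σ = ∑_ϑ R_σ^ϑ N_ϑ`. -/
def rotate (R : E 2 → Matrix (Fin n) (Fin n) ℝ) (N : Fin n → E 2 → E (n + 2)) :
    Fin n → E 2 → E (n + 2) :=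
  fun σ w => ∑ ϑ : Fin n, R w σ ϑ • N ϑ w

/-- The class `H^{1,2}(B, SO(n))`. -/
def MemH12SO (R : E 2 → Matrix (Fin n) (Fin n) ℝ) : Prop :=
  (∀ σ ϑ, MemH12 fun w => R w σ ϑ) ∧
    ∀ᵐ w ∂(volume.restrict disc), R w ∈ Matrix.specialOrthogonalGroup (Fin n) ℝ

/-- A smooth perturbation `A` on the closed disc with values in `so(n)`. -/
def IsSkewPerturbation (A : E 2 → Matrix (Fin n) (Fin n) ℝ) : Prop :=
  (∀ σ ϑ, ContDiffOn ℝ ∞ (fun w => A w σ ϑ) closedDisc) ∧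
    ∀ w ∈ closedDisc, (A w).transpose = -A w

/-- A one-parameter family of rotations `R(w,ε)`, smooth for `w` in the closed disc and
`|ε| < ε₀`, with `R(w,0)` the unit matrix and `∂R/∂ε(w,0) = A(w)`. -/
structure IsRotationFamily (A : E 2 → Matrix (Fin n) (Fin n) ℝ) (ε₀ : ℝ)
    (R : ℝ → E 2 → Matrix (Fin n) (Fin n) ℝ) : Prop where
  pos : 0 < ε₀
  smooth : ∀ σ ϑ, ContDiffOn ℝ ∞ (fun p : E 2 × ℝ => R p.2 p.1 σ ϑ)
    (closedDisc ×ˢ Set.Ioo (-ε₀) ε₀)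
  mem_SO : ∀ w ∈ closedDisc, ∀ ε ∈ Set.Ioo (-ε₀) ε₀,
    R ε w ∈ Matrix.specialOrthogonalGroup (Fin n) ℝ
  at_zero : ∀ w ∈ closedDisc, R 0 w = 1
  deriv_at_zero : ∀ w ∈ closedDisc, ∀ σ ϑ, HasDerivAt (fun ε => R ε w σ ϑ) (A w σ ϑ) 0

/-- A weak normal Coulomb frame: a weak normal frame that is critical for the total torsion,
i.e. the first variation `lim_{ε → 0} ε⁻¹ (𝒯(R(·,ε) N) - 𝒯(N))` exists and vanishes for all
skew-symmetric perturbations `A` and all rotation families generated by them. -/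
def IsWeakNormalCoulombFrame (X : E 2 → E (n + 2)) (N : Fin n → E 2 → E (n + 2)) : Prop :=
  IsWeakNormalFrame X N ∧
    ∀ A : E 2 → Matrix (Fin n) (Fin n) ℝ, IsSkewPerturbation A →
      ∀ (ε₀ : ℝ) (R : ℝ → E 2 → Matrix (Fin n) (Fin n) ℝ), IsRotationFamily A ε₀ R →
        Filter.Tendsto (fun ε => ε⁻¹ * (totalTorsion X (rotate (R ε) N) - totalTorsion X N))
          (nhdsWithin 0 {0}ᶜ) (nhds 0)

end Surface

end CoulombFrame

end

open CoulombFrame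

noncomputable section

namespace CoulombFrame

open Filter Topology

local notation "μB" => (Measure.restrict volume disc : Measure (E 2))

/-! The theorem is a constrained Dirichlet problem in disguise. In conformal parameters `g^{ij} W`
is the Kronecker delta (`inv_firstForm_mul_areaElement`), so the total torsion is the integral of
the squared normal components of the derivatives of the frame. The tangential components are found
by differentiating `X_{u^j} · N_σ = 0`: they equal `-N_σ · X_{u^i u^j}`. Summed over `σ`, their
squares depend only on the normal projection of `X_{u^i u^j}`, hence not on the frame. So total
torsion and Dirichlet energy differ by a constant on weak normal frames
(`IsWeakNormalFrame.totalTorsion_eq`).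

The Dirichlet energy is minimized by the direct method (`exists_dirichlet_minimizer`). Frame vectors
are unit vectors, so a minimizing sequence is bounded in `H^{1,2}`. A subsequence converges weakly
and, by a local Rellich theorem, almost everywhere (`exists_subseq_ae_tendsto_memH12`). The energy
is weakly lower semicontinuous, and the pointwise constraints survive almost everywhere limits
because they can be written as closed conditions (`isNormalBasisAt_iff`). Rellich's theorem is
proved on the Fourier side: after a cut-off, high frequencies are controlled by the gradient and low
ones by weak convergence.

The class of competitors is nonempty because a normal frame at the origin can be transported along
the radii in small steps (`exists_orthonormal_normal_field`).

The energy is differentiable along a rotation family, which stays within the weak normal frames, so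
a minimizer is critical. Finally, the matrix of inner products of a weak frame with a fixed `C¹`
frame is a rotation of class `H^{1,2}`, and conversely each such rotation gives a weak frame;
minimizing over frames and over rotations is therefore the same problem. -/

theorem isOpen_disc : IsOpen disc := Metric.isOpen_ball

theorem measurableSet_disc : MeasurableSet disc := isOpen_disc.measurableSet

theorem disc_subset_closedDisc : disc ⊆ closedDisc := Metric.ball_subset_closedBall

theorem isCompact_closedDisc : IsCompact closedDisc := isCompact_closedBall _ _

theorem closedDisc_mem_nhds {w : E 2} (hw : w ∈ disc) : closedDisc ∈ 𝓝 w :=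
  mem_of_superset (isOpen_disc.mem_nhds hw) disc_subset_closedDisc

theorem uniqueDiffOn_closedDisc : UniqueDiffOn ℝ closedDisc :=
  uniqueDiffOn_convex (convex_closedBall _ _)
    ⟨0, interior_mono disc_subset_closedDisc
      (by rw [isOpen_disc.interior_eq]; simp [disc])⟩

instance isFiniteMeasure_disc : IsFiniteMeasure μB :=
  ⟨by rw [Measure.restrict_apply_univ]; exact measure_ball_lt_top⟩

theorem ae_mem_disc : ∀ᵐ w ∂μB, w ∈ disc := ae_restrict_mem measurableSet_disc

/-! ### Mollification of test functions -/

section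

variable {F : Type*} [NormedAddCommGroup F] [NormedSpace ℝ F]

/-- Mollifications of a continuous function with compact support in the disc converge weakly
against locally integrable functions. -/
theorem tendsto_integral_mollify {K : Set (E 2)} (hK : IsCompact K) {δ : ℝ}
    (hKδ : Metric.cthickening δ K ⊆ disc) (ρ : ℕ → ContDiffBump (0 : E 2))
    (hρ : ∀ m, (ρ m).rOut ≤ δ) (hρ0 : Tendsto (fun m => (ρ m).rOut) atTop (𝓝 0))
    {ψ : E 2 → ℝ} (hψ : Continuous ψ) (hψK : tsupport ψ ⊆ K) {h : E 2 → F}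
    (hh : LocallyIntegrableOn h disc volume) :
    Tendsto (fun m => ∫ w in disc,
      (convolution ((ρ m).normed volume) ψ (ContinuousLinearMap.lsmul ℝ ℝ) volume w) • h w)
      atTop (𝓝 (∫ w in disc, ψ w • h w)) := by
  have hsub : ∀ m, Function.support
      (convolution ((ρ m).normed volume) ψ (ContinuousLinearMap.lsmul ℝ ℝ) volume) ⊆
      Metric.cthickening δ K := by
    intro m x hx
    obtain ⟨a, ha, b, hb, rfl⟩ := support_convolution_subset _ hx
    rw [ContDiffBump.support_normed_eq] at ha
    refine Metric.mem_cthickening_of_dist_le _ b _ _ (hψK (subset_tsupport _ hb)) ?_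
    have : dist (a + b) b = ‖a‖ := by simp [dist_eq_norm]
    rw [this]
    exact (mem_ball_zero_iff.1 ha).le.trans (hρ m)
  have hcs : HasCompactSupport ψ := hK.of_isClosed_subset (isClosed_tsupport _) hψK
  obtain ⟨C, hC⟩ := hψ.bounded_above_of_compact_support hcs
  have hK' : IsCompact (Metric.cthickening δ K) := hK.cthickening
  have hint : IntegrableOn h (Metric.cthickening δ K) :=
    hh.integrableOn_compact_subset hKδ hK'
  have hmK : MeasurableSet (Metric.cthickening δ K) := hK'.measurableSet
  have hloc : AEStronglyMeasurable h μB :=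
    hh.aestronglyMeasurable
  -- `C` bounds `|ψ|`, so the mollification differs from `ψ` by at most `2C`; this gives the
  -- constant `3C`.
  refine tendsto_integral_of_dominated_convergence
    (fun w => (Metric.cthickening δ K).indicator (fun w => (3 * C) * ‖h w‖) w) ?_ ?_ ?_ ?_
  · intro m
    refine AEStronglyMeasurable.smul ?_ hloc
    refine Continuous.aestronglyMeasurable ?_
    exact (((ρ m).hasCompactSupport_normed).contDiff_convolution_left (n := 0) _
      (ρ m).contDiff_normed hψ.locallyIntegrable).continuous
  · exact ((integrable_indicator_iff hmK).2 (hint.norm.const_mul _)).restrict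
  · intro m
    refine ae_of_all _ fun w => ?_
    by_cases hw : w ∈ Metric.cthickening δ K
    · rw [Set.indicator_of_mem hw, norm_smul]
      gcongr
      have h1 := ContDiffBump.dist_normed_convolution_le (φ := ρ m) (g := ψ) (x₀ := w)
        (μ := volume) (ε := 2 * C) hψ.aestronglyMeasurable (fun x _ => by
          rw [dist_eq_norm]
          exact (norm_sub_le _ _).trans (by linarith [hC x, hC w]))
      rw [dist_eq_norm] at h1
      have h2 := norm_le_norm_add_norm_sub (ψ w)
        (convolution ((ρ m).normed volume) ψ (ContinuousLinearMap.lsmul ℝ ℝ) volume w)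
      rw [norm_sub_rev] at h2
      have := hC w
      linarith
    · rw [Set.indicator_of_notMem hw]
      have : convolution ((ρ m).normed volume) ψ (ContinuousLinearMap.lsmul ℝ ℝ) volume w = 0 := by
        by_contra hne
        exact hw (hsub m hne)
      simp [this]
  · refine ae_of_all _ fun w => ?_
    exact (ContDiffBump.convolution_tendsto_right_of_continuous hρ0 hψ w).smul_const _

/-- The defining identity of weak derivatives extends to test functions of class `C¹`. -/
theorem HasWeakPartial.integral_eq_of_contDiff_one {i : Fin 2} {f g : E 2 → F}
    (h : HasWeakPartial i f g) {φ : E 2 → ℝ} (hφ : ContDiff ℝ 1 φ) (hc : HasCompactSupport φ)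
    (hs : tsupport φ ⊆ disc) :
    ∫ w in disc, fderiv ℝ φ w (dir i) • f w = - ∫ w in disc, φ w • g w := by
  obtain ⟨δ, hδ, hKδ⟩ := hc.isCompact.exists_cthickening_subset_open isOpen_disc hs
  -- The outer radii are at most `δ`, so every mollification keeps its support in the compact
  -- thickening inside the disc and is an admissible test function.
  let ρ : ℕ → ContDiffBump (0 : E 2) := fun m =>
    ⟨δ / (m + 1) / 2, δ / (m + 1), by positivity, by
      have : 0 < δ / ((m : ℝ) + 1) := by positivity
      linarith⟩
  have hρ : ∀ m, (ρ m).rOut ≤ δ := fun m =>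
    div_le_self hδ.le (by linarith [(Nat.cast_nonneg m : (0 : ℝ) ≤ m)])
  have hρ0 : Tendsto (fun m => (ρ m).rOut) atTop (𝓝 0) :=
    by simpa [ρ, div_eq_mul_inv] using
      (tendsto_one_div_add_atTop_nhds_zero_nat (𝕜 := ℝ)).const_mul δ
  have hdcont : Continuous fun w => fderiv ℝ φ w (dir i) :=
    (hφ.continuous_fderiv one_ne_zero).clm_apply continuous_const
  have hdsupp : tsupport (fun w => fderiv ℝ φ w (dir i)) ⊆ tsupport φ :=
    tsupport_fderiv_apply_subset ℝ (dir i)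
  have t1 := tendsto_integral_mollify hc.isCompact hKδ ρ hρ hρ0 hdcont hdsupp h.locInt
  have t2 := (tendsto_integral_mollify hc.isCompact hKδ ρ hρ hρ0 hφ.continuous le_rfl
    h.locInt_deriv).neg
  refine tendsto_nhds_unique t1 (t2.congr fun m => ?_)
  set φm := convolution ((ρ m).normed volume) φ (ContinuousLinearMap.lsmul ℝ ℝ) volume with hφm
  have hsub : tsupport φm ⊆ Metric.cthickening δ (tsupport φ) := by
    refine closure_minimal ?_ Metric.isClosed_cthickening
    intro x hx
    obtain ⟨a, ha, b, hb, rfl⟩ := support_convolution_subset _ hx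
    rw [ContDiffBump.support_normed_eq] at ha
    refine Metric.mem_cthickening_of_dist_le _ b _ _ (subset_tsupport _ hb) ?_
    have : dist (a + b) b = ‖a‖ := by simp [dist_eq_norm]
    rw [this]
    exact (mem_ball_zero_iff.1 ha).le.trans (hρ m)
  have hcm : HasCompactSupport φm :=
    hc.isCompact.cthickening.of_isClosed_subset (isClosed_tsupport _) hsub
  have hsm : ContDiff ℝ ∞ φm :=
    ((ρ m).hasCompactSupport_normed).contDiff_convolution_left _
      (ρ m).contDiff_normed hφ.continuous.locallyIntegrable
  rw [← h.integral_eq φm hsm hcm (hsub.trans hKδ)]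
  refine integral_congr_ae (ae_of_all _ fun w => ?_)
  simp only
  congr 1
  -- The derivative falls on the factor `φ`: differentiating the mollification gives the
  -- mollification of the derivative.
  have hd := hc.hasFDerivAt_convolution_right (ContinuousLinearMap.lsmul ℝ ℝ)
    (f := (ρ m).normed volume) (μ := volume)
    ((ρ m).continuous_normed.locallyIntegrable) hφ w
  rw [hd.fderiv, convolution_precompR_apply]
  · exact ((ρ m).continuous_normed.locallyIntegrable)
  · exact hc.fderiv ℝ
  · exact hφ.continuous_fderiv one_ne_zero

/-! ### Calculus of weak derivatives -/

theorem HasWeakPartial.ae_eq [CompleteSpace F] {i : Fin 2} {f g g' : E 2 → F}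
    (h : HasWeakPartial i f g) (h' : HasWeakPartial i f g') : g =ᵐ[μB] g' := by
  have hi : ∀ᵐ x ∂(volume : Measure (E 2)), x ∈ disc → (g - g') x = 0 := by
    refine isOpen_disc.ae_eq_zero_of_integral_contDiff_smul_eq_zero
      (h.locInt_deriv.sub h'.locInt_deriv) ?_
    intro φ hφ hc hs
    have hint : ∀ {k : E 2 → F}, LocallyIntegrableOn k disc volume →
        Integrable (fun w => φ w • k w) volume := fun {k} hk => by
      have h1 : IntegrableOn (fun w => φ w • k w) (tsupport φ) volume := by
        have := (hk.integrableOn_compact_subset hs hc)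
        exact this.continuousOn_smul hφ.continuous.continuousOn hc
      exact (integrableOn_iff_integrable_of_support_subset
        ((Function.support_smul_subset_left _ _).trans (subset_tsupport _))).1 h1
    have e : ∀ k : E 2 → F, ∫ w in disc, φ w • k w = ∫ w, φ w • k w := fun k =>
      setIntegral_eq_integral_of_forall_compl_eq_zero fun x hx => by
        rw [image_eq_zero_of_notMem_tsupport (fun hx' => hx (hs hx')), zero_smul]
    have e1 := h.integral_eq φ hφ hc hs
    have e2 := h'.integral_eq φ hφ hc hs
    rw [e1, neg_inj, e, e] at e2
    simp only [Pi.sub_apply, smul_sub]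
    rw [integral_sub (hint h.locInt_deriv) (hint h'.locInt_deriv), e2, sub_self]
  rw [EventuallyEq, ae_restrict_iff' measurableSet_disc]
  filter_upwards [hi] with x hx hxd
  exact sub_eq_zero.1 (hx hxd)

theorem HasWeakPartial.congr {i : Fin 2} {f f' g g' : E 2 → F}
    (h : HasWeakPartial i f g) (hf : f =ᵐ[μB] f') (hg : g =ᵐ[μB] g') :
    HasWeakPartial i f' g' := by
  have aux : ∀ {k k' : E 2 → F}, k =ᵐ[μB] k' → LocallyIntegrableOn k disc volume →
      LocallyIntegrableOn k' disc volume := by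
    intro k k' hkk hk
    rw [locallyIntegrableOn_iff (isOpen_disc.isLocallyClosed)] at hk ⊢
    intro K hK hKc
    exact (hk K hK hKc).congr_fun_ae (ae_restrict_of_ae_restrict_of_subset hK hkk)
  refine ⟨aux hf h.locInt, aux hg h.locInt_deriv, fun φ h1 h2 h3 => ?_⟩
  have e1 : ∫ w in disc, fderiv ℝ φ w (dir i) • f' w = ∫ w in disc, fderiv ℝ φ w (dir i) • f w :=
    integral_congr_ae (by filter_upwards [hf] with w hw; rw [hw])
  have e2 : ∫ w in disc, φ w • g' w = ∫ w in disc, φ w • g w :=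
    integral_congr_ae (by filter_upwards [hg] with w hw; rw [hw])
  rw [e1, e2, h.integral_eq φ h1 h2 h3]

theorem HasWeakPartial.weakPartial {i : Fin 2} {f g : E 2 → F}
    (h : HasWeakPartial i f g) : HasWeakPartial i f (weakPartial i f) := by
  have hex : ∃ g, HasWeakPartial i f g := ⟨g, h⟩
  rw [CoulombFrame.weakPartial, dif_pos hex]
  exact hex.choose_spec

theorem HasWeakPartial.weakPartial_ae_eq [CompleteSpace F] {i : Fin 2} {f g : E 2 → F}
    (h : HasWeakPartial i f g) : CoulombFrame.weakPartial i f =ᵐ[μB] g :=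
  h.weakPartial.ae_eq h

theorem MemH12.hasWeakPartial {f : E 2 → F} (h : MemH12 f) (i : Fin 2) :
    HasWeakPartial i f (weakPartial i f) :=
  (h.2 i).choose_spec.1.weakPartial

theorem MemH12.memLp_weakPartial [CompleteSpace F] {f : E 2 → F} (h : MemH12 f) (i : Fin 2) :
    MemLp (weakPartial i f) 2 μB :=
  (h.2 i).choose_spec.2.ae_eq (h.2 i).choose_spec.1.weakPartial_ae_eq.symm

theorem integrable_smul_test {φ : E 2 → ℝ} (hφ : Continuous φ) (hc : HasCompactSupport φ)
    (hs : tsupport φ ⊆ disc) {k : E 2 → F} (hk : LocallyIntegrableOn k disc volume) :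
    Integrable (fun w => φ w • k w) μB := by
  have h1 : IntegrableOn (fun w => φ w • k w) (tsupport φ) volume :=
    (hk.integrableOn_compact_subset hs hc).continuousOn_smul hφ.continuousOn hc
  exact ((integrableOn_iff_integrable_of_support_subset
    ((Function.support_smul_subset_left _ _).trans (subset_tsupport _))).1 h1).restrict

theorem continuous_fderiv_dir {φ : E 2 → ℝ} (hφ : ContDiff ℝ 1 φ) (i : Fin 2) :
    Continuous fun w => fderiv ℝ φ w (dir i) :=
  (hφ.continuous_fderiv one_ne_zero).clm_apply continuous_const

theorem integrable_fderiv_smul_test {φ : E 2 → ℝ} (hφ : ContDiff ℝ 1 φ)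
    (hc : HasCompactSupport φ) (hs : tsupport φ ⊆ disc) (i : Fin 2) {k : E 2 → F}
    (hk : LocallyIntegrableOn k disc volume) :
    Integrable (fun w => fderiv ℝ φ w (dir i) • k w) μB :=
  integrable_smul_test (continuous_fderiv_dir hφ i) (hc.fderiv_apply ℝ (dir i))
    ((tsupport_fderiv_apply_subset ℝ (dir i)).trans hs) hk

theorem HasWeakPartial.clm {G : Type*} [NormedAddCommGroup G] [NormedSpace ℝ G]
    [CompleteSpace F] [CompleteSpace G]
    {i : Fin 2} {f g : E 2 → F} (h : HasWeakPartial i f g) (T : F →L[ℝ] G) :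
    HasWeakPartial i (fun w => T (f w)) (fun w => T (g w)) := by
  have aux : ∀ {k : E 2 → F}, LocallyIntegrableOn k disc volume →
      LocallyIntegrableOn (fun w => T (k w)) disc volume := by
    intro k hk
    rw [locallyIntegrableOn_iff (isOpen_disc.isLocallyClosed)] at hk ⊢
    intro K hK hKc
    exact T.integrable_comp (hk K hK hKc)
  refine ⟨aux h.locInt, aux h.locInt_deriv, fun φ h1 h2 h3 => ?_⟩
  have h1' : ContDiff ℝ 1 φ := h1.of_le (by exact_mod_cast le_top)
  have e := congrArg T (h.integral_eq φ h1 h2 h3)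
  rw [map_neg, ← T.integral_comp_comm (integrable_fderiv_smul_test h1' h2 h3 i h.locInt),
    ← T.integral_comp_comm (integrable_smul_test h1.continuous h2 h3 h.locInt_deriv)] at e
  simpa only [map_smul] using e

theorem HasWeakPartial.sum {ι : Type*} {s : Finset ι} {i : Fin 2} {f g : ι → E 2 → F}
    (h : ∀ c ∈ s, HasWeakPartial i (f c) (g c)) :
    HasWeakPartial i (fun w => ∑ c ∈ s, f c w) (fun w => ∑ c ∈ s, g c w) := by
  have aux : ∀ {k : ι → E 2 → F}, (∀ c ∈ s, LocallyIntegrableOn (k c) disc volume) →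
      LocallyIntegrableOn (fun w => ∑ c ∈ s, k c w) disc volume := by
    intro k hk
    rw [locallyIntegrableOn_iff (isOpen_disc.isLocallyClosed)]
    intro K hK hKc
    exact integrable_finsetSum _ fun c hc => (hk c hc).integrableOn_compact_subset hK hKc
  refine ⟨aux fun c hc => (h c hc).locInt, aux fun c hc => (h c hc).locInt_deriv,
    fun φ h1 h2 h3 => ?_⟩
  have h1' : ContDiff ℝ 1 φ := h1.of_le (by exact_mod_cast le_top)
  simp only [Finset.smul_sum]
  rw [integral_finsetSum _ fun c hc => integrable_fderiv_smul_test h1' h2 h3 i (h c hc).locInt,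
    integral_finsetSum _ fun c hc => integrable_smul_test h1.continuous h2 h3
      (h c hc).locInt_deriv, ← Finset.sum_neg_distrib]
  exact Finset.sum_congr rfl fun c hc => (h c hc).integral_eq φ h1 h2 h3

end

/-! ### Products of Sobolev functions with functions smooth up to the boundary -/

theorem aestronglyMeasurable_of_continuousOn {F : Type*} [NormedAddCommGroup F]
    {a : E 2 → F} (ha : ContinuousOn a closedDisc) :
    AEStronglyMeasurable a μB :=
  (ha.mono disc_subset_closedDisc).aestronglyMeasurable_of_isSeparable measurableSet_disc
    (isCompact_closedDisc.isSeparable.mono disc_subset_closedDisc)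

theorem exists_bound_of_continuousOn {F : Type*} [NormedAddCommGroup F]
    {a : E 2 → F} (ha : ContinuousOn a closedDisc) :
    ∃ C : ℝ, 0 ≤ C ∧ ∀ w ∈ closedDisc, ‖a w‖ ≤ C := by
  obtain ⟨C, hC⟩ := isCompact_closedDisc.exists_bound_of_continuousOn ha
  exact ⟨max C 0, le_max_right _ _, fun w hw => (hC w hw).trans (le_max_left _ _)⟩

theorem locallyIntegrableOn_of_memLp {F : Type*} [NormedAddCommGroup F]
    {f : E 2 → F} (hf : MemLp f 2 μB) :
    LocallyIntegrableOn f disc volume :=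
  IntegrableOn.locallyIntegrableOn (hf.integrable (by norm_num))

theorem memLp_of_continuousOn {F : Type*} [NormedAddCommGroup F]
    {a : E 2 → F} (ha : ContinuousOn a closedDisc) (p : ENNReal) :
    MemLp a p μB := by
  obtain ⟨C, _, hC⟩ := exists_bound_of_continuousOn ha
  refine MemLp.of_bound (aestronglyMeasurable_of_continuousOn ha) C ?_
  filter_upwards [ae_mem_disc] with w hw using hC w (disc_subset_closedDisc hw)

section

variable {F : Type*} [NormedAddCommGroup F] [NormedSpace ℝ F]

/-- The partial derivative of a function of class `C¹` on the closed disc. -/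
def pd (a : E 2 → F) (i : Fin 2) (w : E 2) : F := fderivWithin ℝ a closedDisc w (dir i)

theorem pd_eq_fderiv {a : E 2 → F} {i : Fin 2} {w : E 2} (hw : w ∈ disc) :
    pd a i w = fderiv ℝ a w (dir i) := by
  rw [pd, fderivWithin_of_mem_nhds (closedDisc_mem_nhds hw)]

theorem continuousOn_pd {a : E 2 → F} (ha : ContDiffOn ℝ 1 a closedDisc) (i : Fin 2) :
    ContinuousOn (pd a i) closedDisc :=
  (ha.continuousOn_fderivWithin uniqueDiffOn_closedDisc le_rfl).clm_apply continuousOn_const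

theorem contDiffOn_pd {a : E 2 → F} {m k : WithTop ℕ∞} (ha : ContDiffOn ℝ k a closedDisc)
    (hm : m + 1 ≤ k) (i : Fin 2) : ContDiffOn ℝ m (pd a i) closedDisc :=
  (ha.fderivWithin uniqueDiffOn_closedDisc hm).clm_apply contDiffOn_const

theorem contDiffAt_of_mem_disc {a : E 2 → F} {k : WithTop ℕ∞} (ha : ContDiffOn ℝ k a closedDisc)
    {w : E 2} (hw : w ∈ disc) : ContDiffAt ℝ k a w :=
  ha.contDiffAt (closedDisc_mem_nhds hw)

theorem memLp_bilin {G V : Type*} [NormedAddCommGroup G] [NormedSpace ℝ G]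
    [NormedAddCommGroup V] [NormedSpace ℝ V] (B : F →L[ℝ] V →L[ℝ] G) {f : E 2 → F}
    {p : ENNReal} (hf : MemLp f p μB) {a : E 2 → V} (ha : ContinuousOn a closedDisc) :
    MemLp (fun w => B (f w) (a w)) p μB := by
  obtain ⟨C, _, hC⟩ := exists_bound_of_continuousOn ha
  refine MemLp.of_le_mul (c := ‖B‖ * C) hf
    (B.aestronglyMeasurable_comp₂ hf.1 (aestronglyMeasurable_of_continuousOn ha)) ?_
  filter_upwards [ae_mem_disc] with w hw
  calc ‖B (f w) (a w)‖ ≤ ‖B‖ * ‖f w‖ * ‖a w‖ := B.le_opNorm₂ _ _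
    _ ≤ ‖B‖ * ‖f w‖ * C := by gcongr; exact hC w (disc_subset_closedDisc hw)
    _ = _ := by ring

/-- The product rule for a weakly differentiable function and a scalar function of class `C¹`. -/
theorem HasWeakPartial.smul {i : Fin 2} {f g : E 2 → F} (h : HasWeakPartial i f g)
    {a : E 2 → ℝ} (ha : ContDiffOn ℝ 1 a closedDisc) :
    HasWeakPartial i (fun w => a w • f w) (fun w => pd a i w • f w + a w • g w) := by
  have hac := ha.continuousOn.mono disc_subset_closedDisc
  have hpc := (continuousOn_pd ha i).mono disc_subset_closedDisc
  have i1 := h.locInt.continuousOn_smul isOpen_disc.isLocallyClosed hac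
  have i2 := h.locInt.continuousOn_smul isOpen_disc.isLocallyClosed hpc
  have i3 := h.locInt_deriv.continuousOn_smul isOpen_disc.isLocallyClosed hac
  refine ⟨i1, i2.add i3, fun φ h1 h2 h3 => ?_⟩
  have h1' : ContDiff ℝ 1 φ := h1.of_le (by exact_mod_cast le_top)
  -- The product is globally `C¹` because it vanishes off the support of `φ`. It need not be
  -- smoother, which is why test functions of class `C¹` had to be admitted.
  have hψ : ContDiff ℝ 1 (fun w => φ w * a w) := by
    rw [contDiff_iff_contDiffAt]
    intro w
    by_cases hw : w ∈ tsupport φ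
    · exact h1'.contDiffAt.mul (contDiffAt_of_mem_disc ha (h3 hw))
    · have : (fun w => φ w * a w) =ᶠ[𝓝 w] fun _ => 0 := by
        filter_upwards [(isClosed_tsupport φ).isOpen_compl.mem_nhds hw] with x hx
        rw [image_eq_zero_of_notMem_tsupport hx, zero_mul]
      exact contDiffAt_const.congr_of_eventuallyEq this
  have hts : tsupport (fun w => φ w * a w) ⊆ tsupport φ := tsupport_mul_subset_left
  have key := h.integral_eq_of_contDiff_one hψ h2.mul_right (hts.trans h3)
  have e1 : ∫ w in disc, fderiv ℝ (fun w => φ w * a w) w (dir i) • f w =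
      ∫ w in disc, (fderiv ℝ φ w (dir i) • (a w • f w) + φ w • (pd a i w • f w)) := by
    refine setIntegral_congr_fun measurableSet_disc fun w hw => ?_
    have hd := (contDiffAt_of_mem_disc ha hw).differentiableAt one_ne_zero
    rw [fderiv_fun_mul (h1'.differentiable one_ne_zero w) hd, pd_eq_fderiv hw]
    simp only [add_apply, smul_apply, smul_eq_mul,
      smul_smul, ← add_smul]
    congr 1
    ring
  rw [e1, integral_add (integrable_fderiv_smul_test h1' h2 h3 i i1)
    (integrable_smul_test h1.continuous h2 h3 i2)] at key
  simp only [smul_add]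
  rw [integral_add (integrable_smul_test h1.continuous h2 h3 i2)
    (integrable_smul_test h1.continuous h2 h3 i3), eq_sub_of_add_eq key, neg_add]
  simp only [smul_smul]
  abel

/-- The product rule for a bilinear pairing of a weakly differentiable function with a function
of class `C¹`. -/
theorem HasWeakPartial.bilin {G V : Type*} [NormedAddCommGroup G] [NormedSpace ℝ G]
    [CompleteSpace F] [CompleteSpace G] [NormedAddCommGroup V] [NormedSpace ℝ V]
    [FiniteDimensional ℝ V] (B : F →L[ℝ] V →L[ℝ] G) {i : Fin 2} {f g : E 2 → F}
    (h : HasWeakPartial i f g) {a : E 2 → V} (ha : ContDiffOn ℝ 1 a closedDisc) :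
    HasWeakPartial i (fun w => B (f w) (a w)) (fun w => B (f w) (pd a i w) + B (g w) (a w)) := by
  -- Expanding `a` in a basis of `V` reduces the claim to scalar factors.
  let b := Module.finBasis ℝ V
  let c : Fin (Module.finrank ℝ V) → (V →L[ℝ] ℝ) := fun j => LinearMap.toContinuousLinearMap (b.coord j)
  have hc : ∀ v : V, ∑ j, c j v • b j = v := fun v => b.sum_repr v
  have hcd : ∀ j, ContDiffOn ℝ 1 (fun w => c j (a w)) closedDisc := fun j =>
    (c j).contDiff.comp_contDiffOn ha
  have hs := HasWeakPartial.sum (s := Finset.univ) fun j _ =>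
    (h.clm (B.flip (b j))).smul (hcd j)
  refine hs.congr (ae_of_all _ fun w => ?_) ?_
  · change _ = B (f w) (a w)
    conv_rhs => rw [← hc (a w)]
    simp [map_sum]
  · filter_upwards [ae_mem_disc] with w hw
    have hpd : ∀ j, pd (fun w => c j (a w)) i w = c j (pd a i w) := fun j => by
      have hd := (contDiffAt_of_mem_disc ha hw).differentiableAt one_ne_zero
      have h2 : HasFDerivAt (fun w => c j (a w)) ((c j).comp (fderiv ℝ a w)) w :=
        (c j).hasFDerivAt.comp w hd.hasFDerivAt
      rw [pd_eq_fderiv hw, pd_eq_fderiv hw, h2.fderiv]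
      rfl
    change _ = B (f w) (pd a i w) + B (g w) (a w)
    conv_rhs => rw [← hc (a w), ← hc (pd a i w)]
    simp [map_sum, hpd, Finset.sum_add_distrib]

theorem hasWeakPartial_const [CompleteSpace F] (c : F) (i : Fin 2) : HasWeakPartial i (fun _ => c) (fun _ => 0) := by
  have hl : ∀ c : F, LocallyIntegrableOn (fun _ : E 2 => c) disc volume := fun c =>
    continuousOn_const.locallyIntegrableOn measurableSet_disc
  refine ⟨hl c, hl 0, fun φ h1 h2 h3 => ?_⟩
  have h1' : ContDiff ℝ 1 φ := h1.of_le (by exact_mod_cast le_top)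
  have hi : Integrable (fun w => fderiv ℝ φ w (dir i)) volume :=
    (continuous_fderiv_dir h1' i).integrable_of_hasCompactSupport (h2.fderiv_apply ℝ (dir i))
  have h0 : ∫ w, fderiv ℝ φ w (dir i) = 0 := by
    have := integral_mul_fderiv_eq_neg_fderiv_mul_of_integrable (μ := (volume : Measure (E 2)))
      (f := fun _ => (1 : ℝ)) (g := φ) (v := dir i) (by simp) (by simpa using hi)
      (by simpa using h1.continuous.integrable_of_hasCompactSupport h2)
      (fun x _ => by fun_prop) (fun x _ => h1'.differentiable one_ne_zero x)
    simpa using this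
  have h4 : ∫ w in disc, fderiv ℝ φ w (dir i) • c = ∫ w, fderiv ℝ φ w (dir i) • c :=
    setIntegral_eq_integral_of_forall_compl_eq_zero fun x hx => by
      rw [image_eq_zero_of_notMem_tsupport
        (fun hx' => hx (h3 (tsupport_fderiv_apply_subset ℝ (dir i) hx'))), zero_smul]
  rw [h4, integral_smul_const, h0]
  simp

/-- A `C¹` function is its own product with the constant `1`, so the product rule contains the
statement; only the constant needs an integration by parts. -/
theorem ContDiffOn.hasWeakPartial [FiniteDimensional ℝ F] {a : E 2 → F}
    (ha : ContDiffOn ℝ 1 a closedDisc) (i : Fin 2) : HasWeakPartial i a (pd a i) := by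
  have : CompleteSpace F := FiniteDimensional.complete ℝ F
  have := (hasWeakPartial_const (1 : ℝ) i).bilin (ContinuousLinearMap.lsmul ℝ ℝ) ha
  simpa using this

theorem ContDiffOn.memH12 [FiniteDimensional ℝ F] {a : E 2 → F}
    (ha : ContDiffOn ℝ 1 a closedDisc) : MemH12 a :=
  ⟨memLp_of_continuousOn ha.continuousOn 2, fun i =>
    ⟨_, ContDiffOn.hasWeakPartial ha i, memLp_of_continuousOn (continuousOn_pd ha i) 2⟩⟩

theorem MemH12.bilin {G V : Type*} [NormedAddCommGroup G] [NormedSpace ℝ G]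
    [CompleteSpace F] [CompleteSpace G] [NormedAddCommGroup V] [NormedSpace ℝ V]
    [FiniteDimensional ℝ V] (B : F →L[ℝ] V →L[ℝ] G) {f : E 2 → F}
    (h : MemH12 f) {a : E 2 → V} (ha : ContDiffOn ℝ 1 a closedDisc) :
    MemH12 (fun w => B (f w) (a w)) :=
  ⟨memLp_bilin B h.1 ha.continuousOn, fun i =>
    ⟨_, (h.hasWeakPartial i).bilin B ha, (memLp_bilin B h.1 (continuousOn_pd ha i)).add
      (memLp_bilin B (h.memLp_weakPartial i) ha.continuousOn)⟩⟩

theorem MemH12.sum {ι : Type*} {s : Finset ι} [CompleteSpace F] {f : ι → E 2 → F}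
    (h : ∀ c ∈ s, MemH12 (f c)) : MemH12 (fun w => ∑ c ∈ s, f c w) :=
  ⟨memLp_finsetSum s fun c hc => (h c hc).1, fun i =>
    ⟨_, HasWeakPartial.sum fun c hc => (h c hc).hasWeakPartial i,
      memLp_finsetSum s fun c hc => (h c hc).memLp_weakPartial i⟩⟩

theorem MemH12.congr {f f' : E 2 → F} (h : MemH12 f) (hf : f =ᵐ[μB] f') : MemH12 f' :=
  ⟨h.1.ae_eq hf, fun i => by
    obtain ⟨g, hg, hg2⟩ := h.2 i
    exact ⟨g, hg.congr hf (ae_eq_refl _), hg2⟩⟩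

theorem weakPartial_congr [CompleteSpace F] {f f' : E 2 → F} {i : Fin 2}
    (h : MemH12 f) (hf : f =ᵐ[μB] f') : weakPartial i f =ᵐ[μB] weakPartial i f' :=
  ((h.hasWeakPartial i).congr hf (ae_eq_refl _)).weakPartial_ae_eq.symm

end

/-! ### Linear algebra of the normal space at a point -/

section Pointwise

variable {n : ℕ} {X : E 2 → E (n + 2)} {w : E 2}

/-- The conformal factor `g_{11} = g_{22}` of the surface. -/
def confFactor (X : E 2 → E (n + 2)) (w : E 2) : ℝ := firstForm X w 0 0

theorem inner_tangentVec (hc : IsConformal X) (hw : w ∈ closedDisc) (i j : Fin 2) :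
    inner ℝ (tangentVec X i w) (tangentVec X j w) = if i = j then confFactor X w else 0 := by
  obtain ⟨h1, h2⟩ := hc w hw
  simp only [firstForm, Matrix.of_apply] at h1 h2
  fin_cases i <;> fin_cases j
  · simp [confFactor, firstForm]
  · simpa using h2
  · simpa [real_inner_comm] using h2
  · simpa [confFactor, firstForm] using h1.symm

theorem confFactor_pos {k : ℕ} {α : ℝ≥0} (hX : IsImmersion k α X) (hw : w ∈ closedDisc) :
    0 < confFactor X w := by
  have := (hX.2 w hw).ne_zero 0
  simp only [confFactor, firstForm, Matrix.of_apply]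
  exact real_inner_self_pos.2 this

theorem firstForm_eq (hc : IsConformal X) (hw : w ∈ closedDisc) :
    firstForm X w = confFactor X w • (1 : Matrix (Fin 2) (Fin 2) ℝ) := by
  ext i j
  rw [firstForm, Matrix.of_apply, inner_tangentVec hc hw]
  simp [Matrix.one_apply]

/-- Conformal invariance in dimension two: the inverse metric scales by the reciprocal of the
conformal factor and the area element by the factor itself. -/
theorem inv_firstForm_mul_areaElement {k : ℕ} {α : ℝ≥0} (hX : IsImmersion k α X)
    (hc : IsConformal X) (hw : w ∈ closedDisc) (i j : Fin 2) :
    (firstForm X w)⁻¹ i j * areaElement X w = if i = j then 1 else 0 := by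
  have hp := confFactor_pos hX hw
  have hA : areaElement X w = confFactor X w := by
    rw [areaElement, firstForm_eq hc hw, Matrix.det_smul]
    simp [Real.sqrt_sq hp.le]
  rw [hA, firstForm_eq hc hw]
  have : (confFactor X w • (1 : Matrix (Fin 2) (Fin 2) ℝ))⁻¹ =
      (confFactor X w)⁻¹ • (1 : Matrix (Fin 2) (Fin 2) ℝ) := by
    refine Matrix.inv_eq_right_inv ?_
    simp [smul_smul, hp.ne']
  rw [this]
  simp only [Matrix.smul_apply, Matrix.one_apply, smul_eq_mul]
  split_ifs
  · field_simp
  · simp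

theorem inner_tangentVec_eq_zero {v : E (n + 2)} (hv : v ∈ normalSpace X w) (i : Fin 2) :
    inner ℝ (tangentVec X i w) v = 0 :=
  (Submodule.mem_orthogonal _ _).1 hv _ (Submodule.subset_span ⟨i, rfl⟩)

theorem mem_normalSpace {v : E (n + 2)} (hv : ∀ i, inner ℝ (tangentVec X i w) v = 0) :
    v ∈ normalSpace X w := by
  rw [normalSpace, Submodule.mem_orthogonal]
  intro u hu
  induction hu using Submodule.span_induction with
  | mem x hx => obtain ⟨i, rfl⟩ := hx; exact hv i
  | zero => simp
  | add x y _ _ hx hy => rw [inner_add_left, hx, hy, add_zero]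
  | smul a x _ hx => rw [inner_smul_left, hx, mul_zero]

theorem IsNormalBasisAt.inner_eq_zero {v : Fin n → E (n + 2)} (h : IsNormalBasisAt X w v)
    (i : Fin 2) (σ : Fin n) : inner ℝ (tangentVec X i w) (v σ) = 0 :=
  inner_tangentVec_eq_zero (h.span_eq ▸ Submodule.subset_span ⟨σ, rfl⟩) i

/-- Completing orthonormal normal vectors by the normalized tangent vectors. -/
theorem exists_orthonormalBasis {k : ℕ} {α : ℝ≥0} (hX : IsImmersion k α X)
    (hc : IsConformal X) (hw : w ∈ closedDisc) {v : Fin n → E (n + 2)} (hv : Orthonormal ℝ v)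
    (hn : ∀ i σ, inner ℝ (tangentVec X i w) (v σ) = 0) :
    ∃ b : OrthonormalBasis (Fin (n + 2)) ℝ (E (n + 2)),
      b 0 = (√(confFactor X w))⁻¹ • tangentVec X 0 w ∧
      b 1 = (√(confFactor X w))⁻¹ • tangentVec X 1 w ∧ ∀ σ : Fin n, b σ.succ.succ = v σ := by
  have hp := confFactor_pos hX hw
  have hs : √(confFactor X w) * √(confFactor X w) = confFactor X w := Real.mul_self_sqrt hp.le
  have hs0 : √(confFactor X w) ≠ 0 := (Real.sqrt_pos.2 hp).ne'
  let e : Fin (n + 2) → E (n + 2) := Matrix.vecCons ((√(confFactor X w))⁻¹ • tangentVec X 0 w)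
    (Matrix.vecCons ((√(confFactor X w))⁻¹ • tangentVec X 1 w) v)
  have hT : ∀ i j, inner ℝ ((√(confFactor X w))⁻¹ • tangentVec X i w)
      ((√(confFactor X w))⁻¹ • tangentVec X j w) = if i = j then (1 : ℝ) else 0 := by
    intro i j
    rw [real_inner_smul_left, real_inner_smul_right, inner_tangentVec hc hw]
    split_ifs
    · rw [← mul_assoc, ← mul_inv, hs, inv_mul_cancel₀ hp.ne']
    · simp
  have hTv : ∀ i σ, inner ℝ ((√(confFactor X w))⁻¹ • tangentVec X i w) (v σ) = 0 := fun i σ => by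
    rw [real_inner_smul_left, hn, mul_zero]
  have hvT : ∀ i σ, inner ℝ (v σ) ((√(confFactor X w))⁻¹ • tangentVec X i w) = 0 := fun i σ => by
    rw [real_inner_comm, hTv]
  have hvv := orthonormal_iff_ite.1 hv
  have he : Orthonormal ℝ e := by
    rw [orthonormal_iff_ite]
    intro a b
    refine Fin.cases ?_ (fun a => ?_) a <;> refine Fin.cases ?_ (fun b => ?_) b
    · simpa [e] using hT 0 0
    · refine Fin.cases ?_ (fun b => ?_) b
      · simpa [e] using hT 0 1
      · simpa [e, Fin.succ_ne_zero, eq_comm] using hTv 0 b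
    · refine Fin.cases ?_ (fun a => ?_) a
      · simpa [e] using hT 1 0
      · simpa [e] using hvT 0 a
    · refine Fin.cases ?_ (fun a => ?_) a <;> refine Fin.cases ?_ (fun b => ?_) b
      · simpa [e] using hT 1 1
      · simpa [e, Fin.succ_succ_ne_one, (Fin.succ_succ_ne_one b).symm] using hTv 1 b
      · simpa [e, Fin.succ_succ_ne_one] using hvT 1 a
      · simpa [e] using hvv a b
  have hcard : Fintype.card (Fin (n + 2)) = Module.finrank ℝ (E (n + 2)) := by simp
  let B := basisOfOrthonormalOfCardEqFinrank he hcard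
  have hB : ⇑B = e := coe_basisOfOrthonormalOfCardEqFinrank he hcard
  refine ⟨B.toOrthonormalBasis (by rw [hB]; exact he), ?_, ?_, fun σ => ?_⟩ <;>
    rw [Module.Basis.coe_toOrthonormalBasis, hB] <;> rfl

/-- Parseval in the completed basis. The point is that `v` is absent from the right-hand side: the
length of the normal projection of `Y` does not depend on the frame. -/
theorem sum_sq_inner_normal {k : ℕ} {α : ℝ≥0} (hX : IsImmersion k α X)
    (hc : IsConformal X) (hw : w ∈ closedDisc) {v : Fin n → E (n + 2)} (hv : Orthonormal ℝ v)
    (hn : ∀ i σ, inner ℝ (tangentVec X i w) (v σ) = 0) (Y : E (n + 2)) :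
    ∑ σ, (inner ℝ (v σ) Y) ^ 2 =
      ‖Y‖ ^ 2 - (confFactor X w)⁻¹ * ∑ j, (inner ℝ (tangentVec X j w) Y) ^ 2 := by
  obtain ⟨b, h0, h1, h2⟩ := exists_orthonormalBasis hX hc hw hv hn
  have hp := confFactor_pos hX hw
  have := b.sum_sq_norm_inner_right Y
  rw [Fin.sum_univ_succ, Fin.sum_univ_succ] at this
  simp only [Fin.succ_zero_eq_one, h0, h1, h2, real_inner_smul_left, Real.norm_eq_abs, sq_abs,
    mul_pow, inv_pow, Real.sq_sqrt hp.le] at this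
  rw [Fin.sum_univ_two, ← this]
  ring

theorem eq_sum_inner_smul {k : ℕ} {α : ℝ≥0} (hX : IsImmersion k α X)
    (hc : IsConformal X) (hw : w ∈ closedDisc) {v : Fin n → E (n + 2)} (hv : Orthonormal ℝ v)
    (hn : ∀ i σ, inner ℝ (tangentVec X i w) (v σ) = 0) {Y : E (n + 2)}
    (hY : ∀ i, inner ℝ (tangentVec X i w) Y = 0) : Y = ∑ σ, inner ℝ Y (v σ) • v σ := by
  obtain ⟨b, h0, h1, h2⟩ := exists_orthonormalBasis hX hc hw hv hn
  have := b.sum_repr' Y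
  rw [Fin.sum_univ_succ, Fin.sum_univ_succ] at this
  simp only [Fin.succ_zero_eq_one, h0, h1, h2, real_inner_smul_left, hY, mul_zero, zero_smul,
    zero_add] at this
  conv_lhs => rw [← this]
  simp only [real_inner_comm]

/-- The columns are an orthonormal basis up to nonzero scalings of the two tangent vectors. -/
theorem orientationDet_ne_zero {k : ℕ} {α : ℝ≥0} (hX : IsImmersion k α X)
    (hc : IsConformal X) (hw : w ∈ closedDisc) {v : Fin n → E (n + 2)} (hv : Orthonormal ℝ v)
    (hn : ∀ i σ, inner ℝ (tangentVec X i w) (v σ) = 0) : orientationDet X w v ≠ 0 := by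
  obtain ⟨b, h0, h1, h2⟩ := exists_orthonormalBasis hX hc hw hv hn
  have hp := confFactor_pos hX hw
  have hs0 : (√(confFactor X w))⁻¹ ≠ 0 := inv_ne_zero (Real.sqrt_pos.2 hp).ne'
  set s : ℝ := √(confFactor X w) with hs
  have hs1 : s ≠ 0 := (Real.sqrt_pos.2 hp).ne'
  let e : Fin (n + 2) → E (n + 2) :=
    Matrix.vecCons (tangentVec X 0 w) (Matrix.vecCons (tangentVec X 1 w) v)
  let u : Fin (n + 2) → ℝˣ := Fin.cons (Units.mk0 s hs1) (Fin.cons (Units.mk0 s hs1) 1)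
  have hli : LinearIndependent ℝ e := by
    have := b.orthonormal.linearIndependent.units_smul u
    have he : e = u • ⇑b := by
      ext1 a
      refine Fin.cases ?_ (fun a => ?_) a
      · simp [e, u, h0, Units.smul_def, smul_smul, hs1]
      · refine Fin.cases ?_ (fun a => ?_) a
        · simp [e, u, h1, Units.smul_def, smul_smul, hs1]
        · simp [e, u, h2]
    rw [he]
    exact this
  have hli2 : LinearIndependent ℝ fun b => (WithLp.ofLp (e b) : Fin (n + 2) → ℝ) :=
    hli.map' (WithLp.linearEquiv 2 ℝ (Fin (n + 2) → ℝ)).toLinearMap (LinearEquiv.ker _)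
  have h3 : IsUnit (Matrix.of fun a b : Fin (n + 2) => (e b) a) := by
    rw [← Matrix.linearIndependent_cols_iff_isUnit]
    exact hli2
  exact ((Matrix.isUnit_iff_isUnit_det _).1 h3).ne_zero

/-- All conditions on the right are closed, so they pass to limits. The strict orientation
inequality may be weakened since the determinant of such vectors never vanishes, and the span is
right because the tangent vectors and `v` exhaust the dimension. -/
theorem isNormalBasisAt_iff {k : ℕ} {α : ℝ≥0} (hX : IsImmersion k α X)
    (hc : IsConformal X) (hw : w ∈ closedDisc) {v : Fin n → E (n + 2)} :
    IsNormalBasisAt X w v ↔ Orthonormal ℝ v ∧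
      (∀ i σ, inner ℝ (tangentVec X i w) (v σ) = 0) ∧ 0 ≤ orientationDet X w v := by
  constructor
  · exact fun h => ⟨h.orthonormal, h.inner_eq_zero, h.oriented.le⟩
  · rintro ⟨hv, hn, hd⟩
    refine ⟨hv, ?_, lt_of_le_of_ne hd (orientationDet_ne_zero hX hc hw hv hn).symm⟩
    refine le_antisymm (Submodule.span_le.2 ?_) fun Y hY => ?_
    · rintro _ ⟨σ, rfl⟩
      exact mem_normalSpace fun i => hn i σ
    · rw [eq_sum_inner_smul hX hc hw hv hn fun i => inner_tangentVec_eq_zero hY i]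
      exact Submodule.sum_mem _ fun σ _ =>
        Submodule.smul_mem _ _ (Submodule.subset_span ⟨σ, rfl⟩)

theorem orientationDet_rotate (v : Fin n → E (n + 2)) (Q : Matrix (Fin n) (Fin n) ℝ) :
    orientationDet X w (fun σ => ∑ ϑ, Q σ ϑ • v ϑ) = Q.det * orientationDet X w v := by
  -- With the two tangent slots frozen, the determinant is an alternating `n`-form in the
  -- coefficient rows on an `n`-dimensional space, hence a multiple of `det`.
  let D : (Fin n → ℝ) [⋀^Fin n]→ₗ[ℝ] ℝ :=
    ((((Matrix.detRowAlternating : (Fin (n + 2) → ℝ) [⋀^Fin (n + 2)]→ₗ[ℝ] ℝ).curryLeft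
      (WithLp.ofLp (tangentVec X 0 w))).curryLeft
      (WithLp.ofLp (tangentVec X 1 w)))).compLinearMap
      (∑ ϑ, (LinearMap.proj ϑ : (Fin n → ℝ) →ₗ[ℝ] ℝ).smulRight (WithLp.ofLp (v ϑ)))
  have hD : ∀ q : Fin n → Fin n → ℝ, D q = orientationDet X w (fun σ => ∑ ϑ, q σ ϑ • v ϑ) := by
    intro q
    rw [orientationDet, ← Matrix.det_transpose]
    simp only [D, AlternatingMap.compLinearMap_apply, AlternatingMap.curryLeft_apply_apply]
    change Matrix.det _ = Matrix.det _
    congr 1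
    ext a b
    refine Fin.cases ?_ (fun a => ?_) a
    · simp
    · refine Fin.cases ?_ (fun a => ?_) a
      · simp
      · simp
  have h1 := D.eq_smul_basis_det (Pi.basisFun ℝ (Fin n))
  have h2 : D Q = D ⇑(Pi.basisFun ℝ (Fin n)) * (Pi.basisFun ℝ (Fin n)).det Q :=
    congrArg (fun f => f Q) h1
  have h3 : (fun σ => ∑ ϑ, (Pi.basisFun ℝ (Fin n) σ) ϑ • v ϑ) = v := by
    funext σ
    simp [Pi.single_apply]
  rw [hD, h3] at h2
  have h4 : (Pi.basisFun ℝ (Fin n)).det Q = Q.det := Pi.basisFun_det_apply _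
  rw [← hD Q, h2, h4, mul_comm]

theorem inner_sum_smul_sum_smul {v : Fin n → E (n + 2)} (hv : Orthonormal ℝ v)
    (p q : Fin n → ℝ) : inner ℝ (∑ ϑ, p ϑ • v ϑ) (∑ ϑ, q ϑ • v ϑ) = ∑ ϑ, p ϑ * q ϑ := by
  rw [hv.inner_sum]
  simp

theorem IsNormalBasisAt.rotate {k : ℕ} {α : ℝ≥0} (hX : IsImmersion k α X)
    (hc : IsConformal X) (hw : w ∈ closedDisc) {v : Fin n → E (n + 2)}
    (h : IsNormalBasisAt X w v) {Q : Matrix (Fin n) (Fin n) ℝ}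
    (hQ : Q ∈ Matrix.specialOrthogonalGroup (Fin n) ℝ) :
    IsNormalBasisAt X w (fun σ => ∑ ϑ, Q σ ϑ • v ϑ) := by
  obtain ⟨hQ1, hQ2⟩ := Matrix.mem_specialOrthogonalGroup_iff.1 hQ
  rw [Matrix.mem_orthogonalGroup_iff] at hQ1
  rw [isNormalBasisAt_iff hX hc hw]
  refine ⟨?_, fun i σ => ?_, ?_⟩
  · rw [orthonormal_iff_ite]
    intro σ τ
    rw [inner_sum_smul_sum_smul h.orthonormal]
    have := congrFun (congrFun hQ1 σ) τ
    simpa [Matrix.mul_apply, Matrix.one_apply] using this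
  · simp [inner_sum, real_inner_smul_right, h.inner_eq_zero]
  · rw [orientationDet_rotate, hQ2, one_mul]
    exact h.oriented.le

/-- Two positively oriented orthonormal bases of the normal space differ by a rotation. -/
theorem IsNormalBasisAt.transition {k : ℕ} {α : ℝ≥0} (hX : IsImmersion k α X)
    (hc : IsConformal X) (hw : w ∈ closedDisc) {v v' : Fin n → E (n + 2)}
    (h : IsNormalBasisAt X w v) (h' : IsNormalBasisAt X w v') :
    (Matrix.of fun σ ϑ => inner ℝ (v σ) (v' ϑ)) ∈ Matrix.specialOrthogonalGroup (Fin n) ℝ ∧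
      ∀ σ, v σ = ∑ ϑ, inner ℝ (v σ) (v' ϑ) • v' ϑ := by
  have hexp : ∀ σ, v σ = ∑ ϑ, inner ℝ (v σ) (v' ϑ) • v' ϑ := fun σ =>
    eq_sum_inner_smul hX hc hw h'.orthonormal h'.inner_eq_zero fun i => h.inner_eq_zero i σ
  refine ⟨?_, hexp⟩
  set Q : Matrix (Fin n) (Fin n) ℝ := Matrix.of fun σ ϑ => inner ℝ (v σ) (v' ϑ) with hQ
  have hQQ : Q * Q.transpose = 1 := by
    ext σ τ
    have h1 := orthonormal_iff_ite.1 h.orthonormal σ τ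
    rw [hexp σ, hexp τ, inner_sum_smul_sum_smul h'.orthonormal] at h1
    simpa [Matrix.mul_apply, Matrix.one_apply, hQ] using h1
  have hdet : orientationDet X w v = Q.det * orientationDet X w v' := by
    rw [← orientationDet_rotate]
    congr 1
    funext σ
    exact hexp σ
  have hpos : 0 < Q.det := by
    have := h.oriented
    rw [hdet] at this
    exact pos_of_mul_pos_left this h'.oriented.le
  have hsq : Q.det * Q.det = 1 := by
    have := congrArg Matrix.det hQQ
    rwa [Matrix.det_mul, Matrix.det_transpose, Matrix.det_one] at this
  rw [Matrix.mem_specialOrthogonalGroup_iff, Matrix.mem_orthogonalGroup_iff]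
  refine ⟨hQQ, ?_⟩
  nlinarith

end Pointwise

/-! ### Total torsion versus Dirichlet energy -/

section Energy

variable {n k : ℕ} {α : ℝ≥0} {X : E 2 → E (n + 2)}

theorem contDiffOn_tangentVec (hk : 3 ≤ k) (hX : IsImmersion k α X) (i : Fin 2) :
    ContDiffOn ℝ 2 (tangentVec X i) closedDisc :=
  contDiffOn_pd (a := X) hX.1.1 (by norm_cast) i

/-- Boundedness is automatic for unit vectors. -/
theorem isWeakNormalFrame_of_memH12 {N : Fin n → E 2 → E (n + 2)} (h : ∀ σ, MemH12 (N σ))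
    (hb : ∀ᵐ w ∂μB, IsNormalBasisAt X w (fun σ => N σ w)) : IsWeakNormalFrame X N where
  memH12 := h
  memLinfty σ := by
    refine MemLp.of_bound (h σ).1.1 1 ?_
    filter_upwards [hb] with w hw using (hw.orthonormal.1 σ).le
  ae_basis := hb

theorem IsWeakNormalFrame.rotate (hX : IsImmersion k α X) (hc : IsConformal X)
    {N : Fin n → E 2 → E (n + 2)} (hb : ∀ᵐ w ∂μB, IsNormalBasisAt X w (fun σ => N σ w))
    {R : E 2 → Matrix (Fin n) (Fin n) ℝ} (h : ∀ σ ϑ, MemH12 (fun w => R w σ ϑ • N ϑ w))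
    (hR : ∀ᵐ w ∂μB, R w ∈ Matrix.specialOrthogonalGroup (Fin n) ℝ) :
    IsWeakNormalFrame X (rotate R N) := by
  refine isWeakNormalFrame_of_memH12 (fun σ => MemH12.sum fun ϑ _ => h σ ϑ) ?_
  filter_upwards [hb, hR, ae_mem_disc] with w h1 h2 h3
  exact h1.rotate hX hc (disc_subset_closedDisc h3) h2

/-- The Dirichlet energy of a frame. -/
def dirichlet (N : Fin n → E 2 → E (n + 2)) : ℝ :=
  ∑ i, ∑ σ, ∫ w in disc, ‖weakPartial i (N σ) w‖ ^ 2

/-- The density of the tangential part of the Dirichlet energy of a normal frame. -/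
def tangentialDensity (X : E 2 → E (n + 2)) (w : E 2) : ℝ :=
  ∑ i, ∑ j, (confFactor X w)⁻¹ * (‖pd (tangentVec X j) i w‖ ^ 2 - (confFactor X w)⁻¹ *
    ∑ l, (inner ℝ (tangentVec X l w) (pd (tangentVec X j) i w)) ^ 2)

/-- Differentiate `N_σ · X_{u^j} = 0` by the weak product rule; weak derivatives of the zero
function vanish almost everywhere. -/
theorem IsWeakNormalFrame.inner_weakPartial (hk : 3 ≤ k) (hX : IsImmersion k α X)
    {N : Fin n → E 2 → E (n + 2)} (hN : IsWeakNormalFrame X N) (i j : Fin 2) (σ : Fin n) :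
    ∀ᵐ w ∂μB, inner ℝ (tangentVec X j w) (weakPartial i (N σ) w) =
      - inner ℝ (N σ w) (pd (tangentVec X j) i w) := by
  have h1 := ((hN.memH12 σ).hasWeakPartial i).bilin
    (innerSL ℝ : E (n + 2) →L[ℝ] E (n + 2) →L[ℝ] ℝ)
    ((contDiffOn_tangentVec hk hX j).of_le one_le_two)
  have h0 : (fun w => (innerSL ℝ : E (n + 2) →L[ℝ] E (n + 2) →L[ℝ] ℝ) (N σ w)
      (tangentVec X j w)) =ᵐ[μB] fun _ => 0 := by
    filter_upwards [hN.ae_basis] with w hw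
    rw [innerSL_apply_apply, real_inner_comm]
    exact hw.inner_eq_zero j σ
  have h2 := (h1.congr h0 (ae_eq_refl _)).ae_eq (hasWeakPartial_const 0 i)
  filter_upwards [h2] with w hw
  have hw' : inner ℝ (N σ w) (pd (tangentVec X j) i w) +
      inner ℝ (weakPartial i (N σ) w) (tangentVec X j w) = 0 := hw
  rw [real_inner_comm]
  linarith

/-- `sum_sq_inner_normal` enters twice: once for the derivative of `N_σ`, to split off its
tangential part, and once for the second derivatives of `X`, to see that this part sums to an
expression free of `N`. -/
theorem IsWeakNormalFrame.sum_sq_torsion (hk : 3 ≤ k) (hX : IsImmersion k α X)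
    (hc : IsConformal X) {N : Fin n → E 2 → E (n + 2)} (hN : IsWeakNormalFrame X N) :
    ∀ᵐ w ∂μB, ∑ i, ∑ σ, ∑ ϑ, torsion N σ ϑ i w ^ 2 =
      ∑ i, ∑ σ, ‖weakPartial i (N σ) w‖ ^ 2 - tangentialDensity X w := by
  have hall : ∀ᵐ w ∂μB, ∀ i j : Fin 2, ∀ σ, inner ℝ (tangentVec X j w) (weakPartial i (N σ) w) =
      - inner ℝ (N σ w) (pd (tangentVec X j) i w) := by
    simp only [ae_all_iff]
    exact fun i j σ => hN.inner_weakPartial hk hX i j σ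
  filter_upwards [hall, hN.ae_basis, ae_mem_disc] with w h1 h2 h3
  have hw := disc_subset_closedDisc h3
  have hs := sum_sq_inner_normal hX hc hw h2.orthonormal h2.inner_eq_zero
  rw [tangentialDensity, ← Finset.sum_sub_distrib]
  refine Finset.sum_congr rfl fun i _ => ?_
  have e1 : ∀ σ, ∑ ϑ, torsion N σ ϑ i w ^ 2 = ‖weakPartial i (N σ) w‖ ^ 2 -
      (confFactor X w)⁻¹ * ∑ j, (inner ℝ (N σ w) (pd (tangentVec X j) i w)) ^ 2 := by
    intro σ
    have := hs (weakPartial i (N σ) w)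
    simp only [h1, neg_sq] at this
    rw [← this]
    exact Finset.sum_congr rfl fun ϑ _ => by rw [torsion, real_inner_comm]
  simp only [e1, Finset.sum_sub_distrib, ← hs]
  congr 1
  simp only [← Finset.mul_sum]
  rw [Finset.sum_comm]

theorem integrable_sq_torsion {N : Fin n → E 2 → E (n + 2)} (hN : IsWeakNormalFrame X N)
    (i : Fin 2) (σ ϑ : Fin n) : Integrable (fun w => torsion N σ ϑ i w ^ 2) μB := by
  have h1 := (hN.memH12 σ).memLp_weakPartial i
  have h2 : MemLp (fun w => torsion N σ ϑ i w) 2 μB := by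
    refine h1.of_le (h1.1.inner (hN.memH12 ϑ).1.1) ?_
    filter_upwards [hN.ae_basis] with w hw
    refine (norm_inner_le_norm _ _).trans ?_
    rw [hw.orthonormal.1 ϑ, mul_one]
  exact h2.integrable_sq

theorem IsWeakNormalFrame.integrable_sq_weakPartial {N : Fin n → E 2 → E (n + 2)}
    (hN : IsWeakNormalFrame X N) (i : Fin 2) (σ : Fin n) :
    Integrable (fun w => ‖weakPartial i (N σ) w‖ ^ 2) μB :=
  ((hN.memH12 σ).memLp_weakPartial i).integrable_norm_pow two_ne_zero

/-- On weak normal frames of a conformally parametrized surface, the total torsion and the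
Dirichlet energy differ by a constant. -/
theorem IsWeakNormalFrame.totalTorsion_eq (hk : 3 ≤ k) (hX : IsImmersion k α X)
    (hc : IsConformal X) {N : Fin n → E 2 → E (n + 2)} (hN : IsWeakNormalFrame X N) :
    totalTorsion X N = dirichlet N - ∫ w in disc, tangentialDensity X w := by
  have hT := fun i σ ϑ => integrable_sq_torsion hN i σ ϑ
  have e1 : totalTorsion X N = ∑ i, ∑ σ, ∑ ϑ, ∫ w in disc, torsion N σ ϑ i w ^ 2 := by
    rw [totalTorsion]
    refine Finset.sum_congr rfl fun i _ => ?_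
    rw [Finset.sum_eq_single i]
    · refine Finset.sum_congr rfl fun σ _ => Finset.sum_congr rfl fun ϑ _ => ?_
      refine setIntegral_congr_fun measurableSet_disc fun w hw => ?_
      have := inv_firstForm_mul_areaElement hX hc (disc_subset_closedDisc hw) i i
      rw [if_pos rfl] at this
      linear_combination torsion N σ ϑ i w ^ 2 * this
    · intro j _ hj
      refine Finset.sum_eq_zero fun σ _ => Finset.sum_eq_zero fun ϑ _ => ?_
      rw [setIntegral_congr_fun (g := fun _ => (0 : ℝ)) measurableSet_disc fun w hw => ?_]
      · simp
      have := inv_firstForm_mul_areaElement hX hc (disc_subset_closedDisc hw) i j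
      rw [if_neg hj.symm] at this
      linear_combination torsion N σ ϑ i w * torsion N σ ϑ j w * this
    · simp
  have hD := fun i σ => hN.integrable_sq_weakPartial i σ
  have e2 : ∑ i, ∑ σ, ∑ ϑ, ∫ w in disc, torsion N σ ϑ i w ^ 2 =
      ∫ w in disc, ∑ i, ∑ σ, ∑ ϑ, torsion N σ ϑ i w ^ 2 := by
    rw [integral_finsetSum _ fun i _ => integrable_finsetSum _ fun σ _ =>
      integrable_finsetSum _ fun ϑ _ => hT i σ ϑ]
    refine Finset.sum_congr rfl fun i _ => ?_
    rw [integral_finsetSum _ fun σ _ => integrable_finsetSum _ fun ϑ _ => hT i σ ϑ]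
    refine Finset.sum_congr rfl fun σ _ => ?_
    rw [integral_finsetSum _ fun ϑ _ => hT i σ ϑ]
  have hDs : Integrable (fun w => ∑ i, ∑ σ, ‖weakPartial i (N σ) w‖ ^ 2) μB :=
    integrable_finsetSum _ fun i _ => integrable_finsetSum _ fun σ _ => hD i σ
  have hTs : Integrable (fun w => ∑ i, ∑ σ, ∑ ϑ, torsion N σ ϑ i w ^ 2) μB :=
    integrable_finsetSum _ fun i _ => integrable_finsetSum _ fun σ _ =>
      integrable_finsetSum _ fun ϑ _ => hT i σ ϑ
  have e3 : dirichlet N = ∫ w in disc, ∑ i, ∑ σ, ‖weakPartial i (N σ) w‖ ^ 2 := by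
    rw [dirichlet, integral_finsetSum _ fun i _ => integrable_finsetSum _ fun σ _ => hD i σ]
    refine Finset.sum_congr rfl fun i _ => ?_
    rw [integral_finsetSum _ fun σ _ => hD i σ]
  have hae := hN.sum_sq_torsion hk hX hc
  -- Writing the density as a difference of two integrable functions makes a separate proof of its
  -- integrability superfluous.
  have htd : tangentialDensity X =ᵐ[μB] fun w => ∑ i, ∑ σ, ‖weakPartial i (N σ) w‖ ^ 2 -
      ∑ i, ∑ σ, ∑ ϑ, torsion N σ ϑ i w ^ 2 := by
    filter_upwards [hae] with w hw
    rw [hw]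
    ring
  rw [e1, e2, e3, integral_congr_ae htd, integral_sub hDs hTs]
  ring

/-- A weak normal frame arises from a normal frame of class `C¹` by a rotation of class
`H^{1,2}`. -/
theorem IsWeakNormalFrame.exists_rotation (hX : IsImmersion k α X) (hc : IsConformal X)
    {N N₀ : Fin n → E 2 → E (n + 2)} (hN : IsWeakNormalFrame X N)
    (h0 : ∀ σ, ContDiffOn ℝ 1 (N₀ σ) closedDisc)
    (hb : ∀ w ∈ closedDisc, IsNormalBasisAt X w (fun σ => N₀ σ w)) :
    ∃ R : E 2 → Matrix (Fin n) (Fin n) ℝ, MemH12SO R ∧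
      ∀ᵐ w ∂μB, ∀ σ, N σ w = CoulombFrame.rotate R N₀ σ w := by
  refine ⟨fun w => Matrix.of fun σ ϑ => inner ℝ (N σ w) (N₀ ϑ w), ⟨fun σ ϑ => ?_, ?_⟩, ?_⟩
  · exact (hN.memH12 σ).bilin (innerSL ℝ : E (n + 2) →L[ℝ] E (n + 2) →L[ℝ] ℝ) (h0 ϑ)
  · filter_upwards [hN.ae_basis, ae_mem_disc] with w h1 h2
    have hw := disc_subset_closedDisc h2
    exact (h1.transition hX hc hw (hb w hw)).1
  · filter_upwards [hN.ae_basis, ae_mem_disc] with w h1 h2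
    have hw := disc_subset_closedDisc h2
    exact (h1.transition hX hc hw (hb w hw)).2

/-- Converse of `IsWeakNormalFrame.exists_rotation`: up to null sets the weak normal frames are
exactly the rotations of one `C¹` frame. -/
theorem MemH12SO.isWeakNormalFrame_rotate (hX : IsImmersion k α X) (hc : IsConformal X)
    {N₀ : Fin n → E 2 → E (n + 2)} (h0 : ∀ σ, ContDiffOn ℝ 1 (N₀ σ) closedDisc)
    (hb : ∀ w ∈ closedDisc, IsNormalBasisAt X w (fun σ => N₀ σ w))
    {Q : E 2 → Matrix (Fin n) (Fin n) ℝ} (hQ : MemH12SO Q) :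
    IsWeakNormalFrame X (CoulombFrame.rotate Q N₀) := by
  refine IsWeakNormalFrame.rotate hX hc ?_ (fun σ ϑ => ?_) hQ.2
  · filter_upwards [ae_mem_disc] with w hw using hb w (disc_subset_closedDisc hw)
  · exact (hQ.1 σ ϑ).bilin (ContinuousLinearMap.lsmul ℝ ℝ) (h0 ϑ)

/-- `weakPartial` is a chosen representative, so frames that agree almost everywhere have
derivatives that agree only almost everywhere. -/
theorem totalTorsion_congr (hk : 3 ≤ k) (hX : IsImmersion k α X) (hc : IsConformal X)
    {N M : Fin n → E 2 → E (n + 2)} (hN : IsWeakNormalFrame X N) (hM : IsWeakNormalFrame X M)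
    (h : ∀ᵐ w ∂μB, ∀ σ, N σ w = M σ w) : totalTorsion X N = totalTorsion X M := by
  rw [hN.totalTorsion_eq hk hX hc, hM.totalTorsion_eq hk hX hc, dirichlet, dirichlet]
  congr 1
  refine Finset.sum_congr rfl fun i _ => Finset.sum_congr rfl fun σ _ => integral_congr_ae ?_
  filter_upwards [weakPartial_congr (i := i) (hN.memH12 σ) (h.mono fun w hw => hw σ)] with w hw
  rw [hw]

end Energy

/-! ### Weak sequential compactness -/

/-- Sequential Banach–Alaoglu in the separable case, transferred from the dual by the Riesz
isomorphism. -/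
theorem exists_subseq_tendsto_inner {H : Type*} [NormedAddCommGroup H] [InnerProductSpace ℝ H]
    [CompleteSpace H] [TopologicalSpace.SeparableSpace H] {x : ℕ → H} {C : ℝ}
    (hx : ∀ j, ‖x j‖ ≤ C) :
    ∃ φ : ℕ → ℕ, StrictMono φ ∧ ∃ a : H, ∀ y,
      Tendsto (fun j => inner ℝ (x (φ j)) y) atTop (𝓝 (inner ℝ a y)) := by
  let u : ℕ → WeakDual ℝ H := fun j => StrongDual.toWeakDual (InnerProductSpace.toDual ℝ H (x j))
  have hu : ∀ j, u j ∈ ⇑WeakDual.toStrongDual ⁻¹' Metric.closedBall (0 : StrongDual ℝ H) C := by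
    intro j
    simpa [u] using hx j
  obtain ⟨L, -, φ, hφ, hL⟩ := WeakDual.isSeqCompact_closedBall ℝ H 0 C hu
  refine ⟨φ, hφ, (InnerProductSpace.toDual ℝ H).symm (WeakDual.toStrongDual L), fun y => ?_⟩
  have := ((WeakDual.eval_continuous y).tendsto L).comp hL
  rw [InnerProductSpace.toDual_symm_apply]
  exact this

theorem exists_subseq_tendsto_inner_family {H : Type*} [NormedAddCommGroup H]
    [InnerProductSpace ℝ H] [CompleteSpace H] [TopologicalSpace.SeparableSpace H]
    {κ : Type*} (s : Finset κ) {x : κ → ℕ → H} {C : ℝ} (hx : ∀ c j, ‖x c j‖ ≤ C) :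
    ∃ φ : ℕ → ℕ, StrictMono φ ∧ ∀ c ∈ s, ∃ a : H, ∀ y,
      Tendsto (fun j => inner ℝ (x c (φ j)) y) atTop (𝓝 (inner ℝ a y)) := by
  classical
  induction s using Finset.induction_on with
  | empty => exact ⟨id, strictMono_id, by simp⟩
  | insert c s _ ih =>
    obtain ⟨φ, hφ, h⟩ := ih
    obtain ⟨ψ, hψ, a, ha⟩ := exists_subseq_tendsto_inner (x := fun j => x c (φ j))
      fun j => hx c (φ j)
    refine ⟨φ ∘ ψ, hφ.comp hψ, fun c' hc' => ?_⟩
    rcases Finset.mem_insert.1 hc' with rfl | hc'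
    · exact ⟨a, ha⟩
    · obtain ⟨a', ha'⟩ := h c' hc'
      exact ⟨a', fun y => (ha' y).comp hψ.tendsto_atTop⟩

/-! ### Plancherel's theorem for integrable functions in `L²` -/

open FourierTransform in
-- The `L²` transform and the Fourier integral are tested against smooth compactly supported
-- functions. For both, the transform can be moved onto the test function: for the first by its
-- agreement with the distributional transform, for the second by Fubini.
theorem fourier_toLp_ae_eq {f : E 2 → ℂ} (h1 : Integrable f volume) (h2 : MemLp f 2 volume) :
    (𝓕 (h2.toLp f) : Lp ℂ 2 (volume : Measure (E 2))) =ᵐ[volume] 𝓕 f := by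
  have hcont : Continuous (𝓕 f) :=
    VectorFourier.fourierIntegral_continuous Real.continuous_fourierChar continuous_inner h1
  have hl1 : LocallyIntegrable (𝓕 (h2.toLp f) : Lp ℂ 2 (volume : Measure (E 2))) volume :=
    (Lp.memLp _).locallyIntegrable (by norm_num)
  have hl2 : LocallyIntegrable (𝓕 f) volume := hcont.locallyIntegrable
  have h0 : ∀ᵐ x ∂(volume : Measure (E 2)),
      ((𝓕 (h2.toLp f) : Lp ℂ 2 (volume : Measure (E 2))) - 𝓕 f : E 2 → ℂ) x = 0 := by
    refine ae_eq_zero_of_integral_contDiff_smul_eq_zero (hl1.sub hl2) fun g hg hgc => ?_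
    have hgc' : HasCompactSupport (fun x => (g x : ℂ)) := hgc.comp_left Complex.ofReal_zero
    have hg' : ContDiff ℝ ∞ (fun x => (g x : ℂ)) := Complex.ofRealCLM.contDiff.comp hg
    let G : SchwartzMap (E 2) ℂ := hgc'.toSchwartzMap hg'
    have hG : ∀ x, G x = (g x : ℂ) := fun x => rfl
    have e1 := congrArg (fun T => T G) (Lp.fourier_toTemperedDistribution_eq (h2.toLp f))
    simp only [TemperedDistribution.fourier_apply, Lp.toTemperedDistribution_apply] at e1
    have e2 : ∫ x, (𝓕 G) x • (h2.toLp f) x = ∫ x, (𝓕 G) x • f x :=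
      integral_congr_ae (by filter_upwards [h2.coeFn_toLp] with x hx; rw [hx])
    have e3 : ∫ x, (𝓕 G) x • f x = ∫ x, G x • 𝓕 f x := by
      have := VectorFourier.integral_fourierIntegral_smul_eq_flip (μ := (volume : Measure (E 2)))
        (ν := (volume : Measure (E 2))) (L := innerₗ (E 2)) (f := G) (g := f)
        Real.continuous_fourierChar continuous_inner G.integrable h1
      rw [flip_innerₗ] at this
      rw [SchwartzMap.fourier_coe]
      exact this
    have i1 : Integrable (fun x => g x • (𝓕 (h2.toLp f) : Lp ℂ 2 (volume : Measure (E 2))) x)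
        volume := hl1.integrable_smul_left_of_hasCompactSupport hg.continuous hgc
    have i2 : Integrable (fun x => g x • 𝓕 f x) volume :=
      hl2.integrable_smul_left_of_hasCompactSupport hg.continuous hgc
    simp only [Pi.sub_apply, smul_sub]
    rw [integral_sub i1 i2, sub_eq_zero]
    rw [e2, e3] at e1
    simpa only [hG, Complex.real_smul, smul_eq_mul] using e1.symm
  filter_upwards [h0] with x hx
  exact sub_eq_zero.1 hx

open FourierTransform in
theorem plancherel {f : E 2 → ℂ} (h1 : Integrable f volume) (h2 : MemLp f 2 volume) :
    MemLp (𝓕 f) 2 volume ∧ ∫ ξ, ‖𝓕 f ξ‖ ^ 2 = ∫ x, ‖f x‖ ^ 2 := by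
  have hae := fourier_toLp_ae_eq h1 h2
  have hm : MemLp (𝓕 f) 2 volume := (Lp.memLp _).ae_eq hae
  refine ⟨hm, ?_⟩
  have e : ∀ F : Lp ℂ 2 (volume : Measure (E 2)), ‖F‖ ^ 2 = ∫ x, ‖F x‖ ^ 2 := fun F => by
    have := L2.inner_def (𝕜 := ℂ) F F
    have h3 : (‖F‖ ^ 2 : ℝ) = RCLike.re (inner ℂ F F) := (inner_self_eq_norm_sq F).symm
    rw [h3, this, ← integral_re (L2.integrable_inner F F)]
    refine integral_congr_ae (ae_of_all _ fun x => ?_)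
    exact inner_self_eq_norm_sq _
  have e1 : ∫ ξ, ‖𝓕 f ξ‖ ^ 2 = ∫ ξ, ‖(𝓕 (h2.toLp f) : Lp ℂ 2 (volume : Measure (E 2))) ξ‖ ^ 2 :=
    integral_congr_ae (by filter_upwards [hae] with x hx; rw [hx])
  have e2 : ∫ x, ‖f x‖ ^ 2 = ∫ x, ‖h2.toLp f x‖ ^ 2 :=
    integral_congr_ae (by filter_upwards [h2.coeFn_toLp] with x hx; rw [hx])
  rw [e1, e2, ← e, ← e, Lp.norm_fourier_eq]

/-! ### Cosine and sine transforms on the disc -/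

/-- The cosine transform of a function on the disc. -/
def cosT (a : E 2 → ℝ) (ξ : E 2) : ℝ := ∫ w in disc, Real.cos (2 * Real.pi * inner ℝ w ξ) * a w

/-- The sine transform of a function on the disc. -/
def sinT (a : E 2 → ℝ) (ξ : E 2) : ℝ := ∫ w in disc, Real.sin (2 * Real.pi * inner ℝ w ξ) * a w

theorem integrable_bdd_mul {a c : E 2 → ℝ} (ha : Integrable a μB) (hc : Continuous c)
    (hb : ∀ w, |c w| ≤ 1) : Integrable (fun w => c w * a w) μB :=
  ha.bdd_mul hc.aestronglyMeasurable (c := 1) (ae_of_all _ fun w => hb w)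

theorem continuous_cos_inner (ξ : E 2) :
    Continuous fun w : E 2 => Real.cos (2 * Real.pi * inner ℝ w ξ) := by fun_prop

theorem continuous_sin_inner (ξ : E 2) :
    Continuous fun w : E 2 => Real.sin (2 * Real.pi * inner ℝ w ξ) := by fun_prop

open FourierTransform in
-- `cosT` and `-sinT` are the real and imaginary parts of the Fourier integral. Both are real
-- pairings of `a` with continuous functions, to which weak convergence in real `L²` applies
-- directly.
theorem norm_sq_fourier_indicator {a : E 2 → ℝ} (ha : Integrable a μB) (ξ : E 2) :
    ‖𝓕 (disc.indicator fun w => (a w : ℂ)) ξ‖ ^ 2 = cosT a ξ ^ 2 + sinT a ξ ^ 2 := by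
  have i1 := integrable_bdd_mul ha (continuous_cos_inner ξ) fun w => Real.abs_cos_le_one _
  have i2 := integrable_bdd_mul ha (continuous_sin_inner ξ) fun w => Real.abs_sin_le_one _
  have e : 𝓕 (disc.indicator fun w => (a w : ℂ)) ξ = (cosT a ξ : ℂ) - (sinT a ξ : ℂ) * Complex.I := by
    have h1 : (fun w => Real.fourierChar (-inner ℝ w ξ) • disc.indicator (fun w => (a w : ℂ)) w) =
        disc.indicator fun w => (((Real.cos (2 * Real.pi * inner ℝ w ξ) * a w : ℝ) : ℂ) -
          ((Real.sin (2 * Real.pi * inner ℝ w ξ) * a w : ℝ) : ℂ) * Complex.I) := by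
      funext w
      by_cases hw : w ∈ disc
      · simp only [Set.indicator_of_mem hw, Circle.smul_def, Real.fourierChar_apply, smul_eq_mul]
        rw [mul_neg, Complex.ofReal_neg, neg_mul, Complex.exp_neg,  Complex.exp_mul_I,
          ← Complex.ofReal_cos, ← Complex.ofReal_sin]
        have hne : ((Real.cos (2 * Real.pi * inner ℝ w ξ) : ℝ) : ℂ) +
            ((Real.sin (2 * Real.pi * inner ℝ w ξ) : ℝ) : ℂ) * Complex.I ≠ 0 := by
          rw [Complex.ofReal_cos, Complex.ofReal_sin, ← Complex.exp_mul_I]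
          exact Complex.exp_ne_zero _
        rw [inv_mul_eq_iff_eq_mul₀ hne]
        have hcs : ((Real.cos (2 * Real.pi * inner ℝ w ξ) : ℝ) : ℂ) ^ 2 +
            ((Real.sin (2 * Real.pi * inner ℝ w ξ) : ℝ) : ℂ) ^ 2 = 1 := by
          exact_mod_cast Real.cos_sq_add_sin_sq _
        push_cast at hcs ⊢
        linear_combination (-(a w : ℂ)) * hcs + (a w : ℂ) *
          (Complex.sin (2 * Real.pi * (inner ℝ w ξ : ℝ))) ^ 2 * Complex.I_sq
      · simp [Set.indicator_of_notMem hw]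
    rw [Real.fourier_eq, h1, integral_indicator measurableSet_disc,
      integral_sub i1.ofReal (i2.ofReal.mul_const _), integral_mul_const, integral_complex_ofReal,
      integral_complex_ofReal]
    rfl
  rw [e, Complex.sq_norm, Complex.normSq_apply]
  simp
  ring

theorem integral_cosT_sq_add_sinT_sq {a : E 2 → ℝ} (ha : MemLp a 2 μB) :
    Integrable (fun ξ => cosT a ξ ^ 2 + sinT a ξ ^ 2) volume ∧
      ∫ ξ, (cosT a ξ ^ 2 + sinT a ξ ^ 2) = ∫ w in disc, a w ^ 2 := by
  have h2 : MemLp (disc.indicator fun w => (a w : ℂ)) 2 volume := by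
    rw [memLp_indicator_iff_restrict measurableSet_disc]
    exact ha.ofReal
  have hai : Integrable a μB := ha.integrable (by norm_num)
  have h1 : Integrable (disc.indicator fun w => (a w : ℂ)) volume := by
    rw [integrable_indicator_iff measurableSet_disc]
    exact hai.ofReal
  obtain ⟨hm, he⟩ := plancherel h1 h2
  have hi := hm.integrable_norm_pow two_ne_zero
  simp only [norm_sq_fourier_indicator hai] at hi he
  refine ⟨hi, he.trans ?_⟩
  rw [← integral_indicator measurableSet_disc]
  congr 1
  funext w
  by_cases hw : w ∈ disc <;> simp [hw]

/-! ### Rellich's compactness theorem -/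

theorem memLp_continuous_mul {η : E 2 → ℝ} (hη : Continuous η) {a : E 2 → ℝ} {p : ENNReal}
    (ha : MemLp a p μB) : MemLp (fun w => η w * a w) p μB := by
  have := memLp_bilin (ContinuousLinearMap.mul ℝ ℝ) ha hη.continuousOn
  simpa [mul_comm] using this

/-- The gradient of a cut-off function, in frequency variables. -/
theorem cosT_sq_add_sinT_sq_cutoff {i : Fin 2} {v g : E 2 → ℝ} (h : HasWeakPartial i v g)
    (hv : MemLp v 2 μB) (hg : MemLp g 2 μB) {η : E 2 → ℝ} (hη : ContDiff ℝ ∞ η)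
    (hc : HasCompactSupport η) (hs : tsupport η ⊆ disc) (ξ : E 2) :
    cosT (fun w => η w * g w + fderiv ℝ η w (dir i) * v w) ξ ^ 2 +
      sinT (fun w => η w * g w + fderiv ℝ η w (dir i) * v w) ξ ^ 2 =
    (2 * Real.pi * ξ i) ^ 2 * (cosT (fun w => η w * v w) ξ ^ 2 +
      sinT (fun w => η w * v w) ξ ^ 2) := by
  have hη1 : ContDiff ℝ 1 η := hη.of_le (by exact_mod_cast le_top)
  have hdη := continuous_fderiv_dir hη1 i
  have hin : ∀ w, HasFDerivAt (fun w : E 2 => 2 * Real.pi * inner ℝ w ξ)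
      ((2 * Real.pi) • (innerSL ℝ ξ : E 2 →L[ℝ] ℝ)) w := fun w => by
    have := ((innerSL ℝ ξ : E 2 →L[ℝ] ℝ).hasFDerivAt (x := w)).const_mul (2 * Real.pi)
    simpa only [innerSL_apply_apply, real_inner_comm] using this
  have hdir : inner ℝ ξ (dir i) = ξ i := by
    rw [dir, EuclideanSpace.inner_single_right]
    simp
  have hcosd : ∀ w, fderiv ℝ (fun w => Real.cos (2 * Real.pi * inner ℝ w ξ) * η w) w (dir i) =
      Real.cos (2 * Real.pi * inner ℝ w ξ) * fderiv ℝ η w (dir i) -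
        2 * Real.pi * ξ i * (Real.sin (2 * Real.pi * inner ℝ w ξ) * η w) := fun w => by
    rw [(((hin w).cos).fun_mul ((hη1.differentiable one_ne_zero w).hasFDerivAt)).fderiv]
    simp [hdir]
    ring
  have hsind : ∀ w, fderiv ℝ (fun w => Real.sin (2 * Real.pi * inner ℝ w ξ) * η w) w (dir i) =
      Real.sin (2 * Real.pi * inner ℝ w ξ) * fderiv ℝ η w (dir i) +
        2 * Real.pi * ξ i * (Real.cos (2 * Real.pi * inner ℝ w ξ) * η w) := fun w => by
    rw [(((hin w).sin).fun_mul ((hη1.differentiable one_ne_zero w).hasFDerivAt)).fderiv]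
    simp [hdir]
    ring
  have hsmc : ContDiff ℝ ∞ (fun w : E 2 => Real.cos (2 * Real.pi * inner ℝ w ξ)) :=
    Real.contDiff_cos.comp (contDiff_const.mul (contDiff_id.inner ℝ contDiff_const))
  have hsms : ContDiff ℝ ∞ (fun w : E 2 => Real.sin (2 * Real.pi * inner ℝ w ξ)) :=
    Real.contDiff_sin.comp (contDiff_const.mul (contDiff_id.inner ℝ contDiff_const))
  have iv : ∀ c : E 2 → ℝ, Continuous c → Integrable (fun w => c w * v w) μB := fun c hcc =>
    (memLp_continuous_mul hcc hv).integrable (by norm_num)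
  have ig : ∀ c : E 2 → ℝ, Continuous c → Integrable (fun w => c w * g w) μB := fun c hcc =>
    (memLp_continuous_mul hcc hg).integrable (by norm_num)
  -- Waves times the cut-off are admissible test functions; this replaces the rule that
  -- differentiation becomes multiplication by the frequency.
  have kc := h.integral_eq _ (hsmc.mul hη) hc.mul_left (tsupport_mul_subset_right.trans hs)
  have ks := h.integral_eq _ (hsms.mul hη) hc.mul_left (tsupport_mul_subset_right.trans hs)
  simp only [hcosd, hsind, smul_eq_mul, sub_mul, add_mul] at kc ks
  have cc := continuous_cos_inner ξ
  have cs := continuous_sin_inner ξ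
  have a1 := iv (fun w => Real.cos (2 * Real.pi * inner ℝ w ξ) * fderiv ℝ η w (dir i)) (cc.mul hdη)
  have a2 := iv (fun w => Real.sin (2 * Real.pi * inner ℝ w ξ) * fderiv ℝ η w (dir i)) (cs.mul hdη)
  have b1 := iv (fun w => 2 * Real.pi * ξ i * (Real.cos (2 * Real.pi * inner ℝ w ξ) * η w))
    (continuous_const.mul (cc.mul hη.continuous))
  have b2 := iv (fun w => 2 * Real.pi * ξ i * (Real.sin (2 * Real.pi * inner ℝ w ξ) * η w))
    (continuous_const.mul (cs.mul hη.continuous))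
  have d1 := ig (fun w => Real.cos (2 * Real.pi * inner ℝ w ξ) * η w) (cc.mul hη.continuous)
  have d2 := ig (fun w => Real.sin (2 * Real.pi * inner ℝ w ξ) * η w) (cs.mul hη.continuous)
  rw [integral_sub a1 b2] at kc
  rw [integral_add a2 b1] at ks
  simp only [mul_assoc (2 * Real.pi * ξ i)] at kc ks
  rw [integral_const_mul] at kc ks
  have ec : cosT (fun w => η w * g w + fderiv ℝ η w (dir i) * v w) ξ =
      2 * Real.pi * ξ i * sinT (fun w => η w * v w) ξ := by
    have e1 : ∀ w, Real.cos (2 * Real.pi * inner ℝ w ξ) *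
        (η w * g w + fderiv ℝ η w (dir i) * v w) =
        Real.cos (2 * Real.pi * inner ℝ w ξ) * η w * g w +
        Real.cos (2 * Real.pi * inner ℝ w ξ) * fderiv ℝ η w (dir i) * v w := fun w => by ring
    have e2 : ∀ w, Real.sin (2 * Real.pi * inner ℝ w ξ) * (η w * v w) =
        Real.sin (2 * Real.pi * inner ℝ w ξ) * η w * v w := fun w => by ring
    simp only [cosT, sinT, e1, e2]
    rw [integral_add d1 a1]
    linarith
  have es : sinT (fun w => η w * g w + fderiv ℝ η w (dir i) * v w) ξ =
      - (2 * Real.pi * ξ i * cosT (fun w => η w * v w) ξ) := by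
    have e1 : ∀ w, Real.sin (2 * Real.pi * inner ℝ w ξ) *
        (η w * g w + fderiv ℝ η w (dir i) * v w) =
        Real.sin (2 * Real.pi * inner ℝ w ξ) * η w * g w +
        Real.sin (2 * Real.pi * inner ℝ w ξ) * fderiv ℝ η w (dir i) * v w := fun w => by ring
    have e2 : ∀ w, Real.cos (2 * Real.pi * inner ℝ w ξ) * (η w * v w) =
        Real.cos (2 * Real.pi * inner ℝ w ξ) * η w * v w := fun w => by ring
    simp only [cosT, sinT, e1, e2]
    rw [integral_add d2 a2]
    linarith
  rw [ec, es]
  ring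

theorem integral_cutoff_sq_le {v g : E 2 → ℝ} {C M : ℝ}
    (hv : MemLp v 2 μB) (hg : MemLp g 2 μB) (bv : ∫ w in disc, v w ^ 2 ≤ C)
    (bg : ∫ w in disc, g w ^ 2 ≤ C) {η η' : E 2 → ℝ} (hη : Continuous η) (hη' : Continuous η')
    (b1 : ∀ w, |η w| ≤ M) (b2 : ∀ w, |η' w| ≤ M) :
    ∫ w in disc, (η w * g w + η' w * v w) ^ 2 ≤ 4 * M ^ 2 * C := by
  have hM : ∀ {x y : ℝ}, |x| ≤ M → (x * y) ^ 2 ≤ M ^ 2 * y ^ 2 := fun {x y} h => by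
    rw [mul_pow, ← sq_abs x]
    gcongr
  have i1 := ((memLp_continuous_mul hη hg).add (memLp_continuous_mul hη' hv)).integrable_sq
  have hle : ∫ w in disc, (η w * g w + η' w * v w) ^ 2 ≤
      ∫ w in disc, (2 * M ^ 2 * g w ^ 2 + 2 * M ^ 2 * v w ^ 2) := by
    refine integral_mono i1 ((hg.integrable_sq.const_mul _).add (hv.integrable_sq.const_mul _))
      fun w => ?_
    have h1 := hM (y := g w) (b1 w)
    have h2 := hM (y := v w) (b2 w)
    have h3 := sq_nonneg (η w * g w - η' w * v w)
    simp only
    nlinarith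
  refine hle.trans ?_
  rw [integral_add (hg.integrable_sq.const_mul _) (hv.integrable_sq.const_mul _),
    integral_const_mul, integral_const_mul]
  nlinarith [mul_le_mul_of_nonneg_left bv (sq_nonneg M), mul_le_mul_of_nonneg_left bg (sq_nonneg M)]

/-- Rellich's theorem, localized by a cut-off function: a sequence that is bounded in `H^{1,2}`
and tends weakly to zero tends strongly to zero. -/
theorem tendsto_integral_cutoff_sq {v : ℕ → E 2 → ℝ} {g : ℕ → Fin 2 → E 2 → ℝ} {C : ℝ}
    (h : ∀ j i, HasWeakPartial i (v j) (g j i)) (hv : ∀ j, MemLp (v j) 2 μB)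
    (hg : ∀ j i, MemLp (g j i) 2 μB) (bv : ∀ j, ∫ w in disc, v j w ^ 2 ≤ C)
    (bg : ∀ j i, ∫ w in disc, g j i w ^ 2 ≤ C)
    (hweak : ∀ a, MemLp a 2 μB → Tendsto (fun j => ∫ w in disc, a w * v j w) atTop (𝓝 0))
    {η : E 2 → ℝ} (hη : ContDiff ℝ ∞ η) (hc : HasCompactSupport η) (hs : tsupport η ⊆ disc) :
    Tendsto (fun j => ∫ w in disc, (η w * v j w) ^ 2) atTop (𝓝 0) := by
  have hη1 : ContDiff ℝ 1 η := hη.of_le (by exact_mod_cast le_top)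
  obtain ⟨M, hM⟩ : ∃ M : ℝ, (∀ w, |η w| ≤ M) ∧ ∀ i w, |fderiv ℝ η w (dir i)| ≤ M := by
    obtain ⟨M1, h1⟩ := hη.continuous.bounded_above_of_compact_support hc
    obtain ⟨M2, h2⟩ := (continuous_fderiv_dir hη1 0).bounded_above_of_compact_support
      (hc.fderiv_apply ℝ (dir 0))
    obtain ⟨M3, h3⟩ := (continuous_fderiv_dir hη1 1).bounded_above_of_compact_support
      (hc.fderiv_apply ℝ (dir 1))
    refine ⟨max M1 (max M2 M3), fun w => (h1 w).trans (le_max_left _ _), fun i w => ?_⟩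
    fin_cases i
    · exact (h2 w).trans ((le_max_left _ _).trans (le_max_right _ _))
    · exact (h3 w).trans ((le_max_right _ _).trans (le_max_right _ _))
  have hC : 0 ≤ C := (integral_nonneg fun w => sq_nonneg _).trans (bv 0)
  have hηv : ∀ j, MemLp (fun w => η w * v j w) 2 μB := fun j =>
    memLp_continuous_mul hη.continuous (hv j)
  let P : ℕ → E 2 → ℝ := fun j ξ =>
    cosT (fun w => η w * v j w) ξ ^ 2 + sinT (fun w => η w * v j w) ξ ^ 2
  have hP0 : ∀ j ξ, 0 ≤ P j ξ := fun j ξ => by positivity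
  have hPi : ∀ j, Integrable (P j) volume := fun j => (integral_cosT_sq_add_sinT_sq (hηv j)).1
  have hPe : ∀ j, ∫ w in disc, (η w * v j w) ^ 2 = ∫ ξ, P j ξ := fun j =>
    (integral_cosT_sq_add_sinT_sq (hηv j)).2.symm
  -- the frequency-weighted integrals are bounded
  have hgrad : ∀ j, Integrable (fun ξ => ‖ξ‖ ^ 2 * P j ξ) volume ∧
      ∫ ξ, ‖ξ‖ ^ 2 * P j ξ ≤ 8 * M ^ 2 * C := by
    intro j
    have hm : ∀ i, MemLp (fun w => η w * g j i w + fderiv ℝ η w (dir i) * v j w) 2 μB := fun i =>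
      (memLp_continuous_mul hη.continuous (hg j i)).add
        (memLp_continuous_mul (continuous_fderiv_dir hη1 i) (hv j))
    have hk : ∀ i, Integrable (fun ξ : E 2 => (2 * Real.pi * ξ i) ^ 2 * P j ξ) volume ∧
        ∫ ξ : E 2, (2 * Real.pi * ξ i) ^ 2 * P j ξ ≤ 4 * M ^ 2 * C := by
      intro i
      obtain ⟨h1, h2⟩ := integral_cosT_sq_add_sinT_sq (hm i)
      simp only [cosT_sq_add_sinT_sq_cutoff (h j i) (hv j) (hg j i) hη hc hs] at h1 h2
      refine ⟨h1, h2.le.trans ?_⟩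
      exact integral_cutoff_sq_le (hv j) (hg j i) (bv j) (bg j i) hη.continuous
        (continuous_fderiv_dir hη1 i) hM.1 (hM.2 i)
    have hle : ∀ ξ : E 2, ‖ξ‖ ^ 2 * P j ξ ≤
        (2 * Real.pi * ξ 0) ^ 2 * P j ξ + (2 * Real.pi * ξ 1) ^ 2 * P j ξ := by
      intro ξ
      rw [← add_mul]
      refine mul_le_mul_of_nonneg_right ?_ (hP0 j ξ)
      rw [EuclideanSpace.norm_sq_eq, Fin.sum_univ_two, Real.norm_eq_abs, Real.norm_eq_abs, sq_abs,
        sq_abs]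
      have hpi : 1 ≤ (2 * Real.pi) ^ 2 := by nlinarith [Real.pi_gt_three]
      rw [mul_pow, mul_pow (2 * Real.pi) (ξ 1)]
      nlinarith [mul_le_mul_of_nonneg_right hpi (sq_nonneg (ξ 0)),
        mul_le_mul_of_nonneg_right hpi (sq_nonneg (ξ 1))]
    have hint : Integrable (fun ξ => ‖ξ‖ ^ 2 * P j ξ) volume := by
      refine ((hk 0).1.add (hk 1).1).mono'
        ((continuous_norm.pow 2).aestronglyMeasurable.mul (hPi j).1) (ae_of_all _ fun ξ => ?_)
      rw [Real.norm_of_nonneg (mul_nonneg (sq_nonneg _) (hP0 j ξ))]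
      exact hle ξ
    refine ⟨hint, ?_⟩
    refine (integral_mono hint ((hk 0).1.add (hk 1).1) hle).trans ?_
    rw [integral_add' (hk 0).1 (hk 1).1]
    linarith [(hk 0).2, (hk 1).2]
  -- pointwise convergence on bounded frequencies
  have hpt : ∀ ξ, Tendsto (fun j => P j ξ) atTop (𝓝 0) := by
    intro ξ
    have aux : ∀ c : E 2 → ℝ, Continuous c →
        Tendsto (fun j => ∫ w in disc, c w * (η w * v j w)) atTop (𝓝 0) := fun c hcc => by
      have := hweak (fun w => c w * η w) (memLp_of_continuousOn (hcc.mul hη.continuous).continuousOn 2)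
      simpa only [mul_assoc] using this
    have := ((aux _ (continuous_cos_inner ξ)).pow 2).add ((aux _ (continuous_sin_inner ξ)).pow 2)
    simpa [P, cosT, sinT] using this
  -- A uniform bound, as majorant for dominated convergence on balls of frequencies.
  obtain ⟨K, hK⟩ : ∃ K : ℝ, ∀ j ξ, P j ξ ≤ K := by
    have hv1 : Integrable (fun _ : E 2 => (1 : ℝ)) μB := integrable_const _
    let K0 := M * ((μB).real Set.univ + C)
    have hb : ∀ c : E 2 → ℝ, (∀ w, |c w| ≤ 1) → ∀ j,
        |∫ w in disc, c w * (η w * v j w)| ≤ K0 := by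
      intro c hcb j
      have hM0 : 0 ≤ M := (abs_nonneg _).trans (hM.1 0)
      rw [← Real.norm_eq_abs]
      refine (norm_integral_le_of_norm_le (g := fun w => M * (1 + v j w ^ 2))
        ((hv1.add (hv j).integrable_sq).const_mul M) (ae_of_all _ fun w => ?_)).trans ?_
      · rw [Real.norm_eq_abs, abs_mul, abs_mul]
        have h1 := hcb w
        have h2 := hM.1 w
        have h3 : |v j w| ≤ 1 + v j w ^ 2 := by
          rw [← sq_abs]
          nlinarith [sq_nonneg (|v j w| - 1), abs_nonneg (v j w)]
        calc |c w| * (|η w| * |v j w|) ≤ 1 * (M * (1 + v j w ^ 2)) := by gcongr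
          _ = _ := one_mul _
      · rw [integral_const_mul, integral_add hv1 (hv j).integrable_sq]
        refine mul_le_mul_of_nonneg_left ?_ hM0
        simp only [integral_const, smul_eq_mul, mul_one]
        exact add_le_add le_rfl (bv j)
    refine ⟨K0 ^ 2 + K0 ^ 2, fun j ξ => ?_⟩
    have h1 := hb (fun w => Real.cos (2 * Real.pi * inner ℝ w ξ))
      (fun w => Real.abs_cos_le_one _) j
    have h2 := hb (fun w => Real.sin (2 * Real.pi * inner ℝ w ξ))
      (fun w => Real.abs_sin_le_one _) j
    exact add_le_add (sq_le_sq' (neg_le_of_abs_le h1) (le_of_abs_le h1))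
      (sq_le_sq' (neg_le_of_abs_le h2) (le_of_abs_le h2))
  have hball : ∀ r : ℝ, Tendsto (fun j => ∫ ξ in Metric.ball (0 : E 2) r, P j ξ) atTop (𝓝 0) := by
    intro r
    have : IsFiniteMeasure ((volume : Measure (E 2)).restrict (Metric.ball 0 r)) :=
      ⟨by rw [Measure.restrict_apply_univ]; exact measure_ball_lt_top⟩
    have := tendsto_integral_of_dominated_convergence
      (μ := (volume : Measure (E 2)).restrict (Metric.ball 0 r)) (F := P) (f := fun _ => 0)
      (fun _ => K) (fun j => (hPi j).1.restrict) (integrable_const K)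
      (fun j => ae_of_all _ fun ξ => by
        rw [Real.norm_of_nonneg (hP0 j ξ)]; exact hK j ξ)
      (ae_of_all _ hpt)
    simpa using this
  simp only [hPe]
  rw [Metric.tendsto_atTop]
  intro ε hε
  have hC8 : 0 ≤ 8 * M ^ 2 * C := by positivity
  -- Beyond radius `r` the weight `‖ξ‖²/r²` is at least `1`, so the tail is at most `8M²C/r²` for
  -- every `j`. The summand `+ 1` in the witness makes `r` positive and the inequality strict.
  obtain ⟨r, hr0, hr⟩ : ∃ r : ℝ, 0 < r ∧ 8 * M ^ 2 * C / r ^ 2 < ε / 2 := by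
    refine ⟨√(8 * M ^ 2 * C / (ε / 2) + 1), Real.sqrt_pos.2 (by positivity), ?_⟩
    rw [Real.sq_sqrt (by positivity), div_lt_iff₀ (by positivity)]
    have : ε / 2 * (8 * M ^ 2 * C / (ε / 2) + 1) = 8 * M ^ 2 * C + ε / 2 := by
      field_simp
    linarith
  obtain ⟨J, hJ⟩ := Metric.tendsto_atTop.1 (hball r) (ε / 2) (by positivity)
  refine ⟨J, fun j hj => ?_⟩
  have h1 := hJ j hj
  have h2 : ∫ ξ in (Metric.ball (0 : E 2) r)ᶜ, P j ξ ≤ 8 * M ^ 2 * C / r ^ 2 := by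
    have hle : ∫ ξ in (Metric.ball (0 : E 2) r)ᶜ, P j ξ ≤
        ∫ ξ in (Metric.ball (0 : E 2) r)ᶜ, (‖ξ‖ ^ 2 * P j ξ) / r ^ 2 := by
      refine setIntegral_mono_on (hPi j).integrableOn ((hgrad j).1.div_const _).integrableOn
        measurableSet_ball.compl fun ξ hξ => ?_
      rw [le_div_iff₀ (by positivity), mul_comm]
      refine mul_le_mul_of_nonneg_right ?_ (hP0 j ξ)
      have : r ≤ ‖ξ‖ := by simpa using hξ
      gcongr
    refine hle.trans ?_
    rw [integral_div]
    gcongr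
    exact (setIntegral_le_integral (hgrad j).1
      (ae_of_all _ fun ξ => mul_nonneg (sq_nonneg _) (hP0 j ξ))).trans (hgrad j).2
  rw [Real.dist_eq, sub_zero] at h1 ⊢
  rw [abs_of_nonneg (integral_nonneg (hP0 j)),
    ← integral_add_compl measurableSet_ball (hPi j)]
  linarith [le_abs_self (∫ ξ in Metric.ball (0 : E 2) r, P j ξ)]

/-! ### From local strong convergence to almost everywhere convergence -/

theorem norm_sq_toLp {a : E 2 → ℝ} (ha : MemLp a 2 μB) :
    ‖ha.toLp a‖ ^ 2 = ∫ w in disc, a w ^ 2 := by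
  rw [← real_inner_self_eq_norm_sq, L2.inner_def]
  refine integral_congr_ae ?_
  filter_upwards [ha.coeFn_toLp] with w hw
  rw [hw, real_inner_self_eq_norm_sq, Real.norm_eq_abs, sq_abs]

theorem inner_toLp {a : E 2 → ℝ} (ha : MemLp a 2 μB) {b : E 2 → ℝ} (hb : MemLp b 2 μB) :
    inner ℝ (ha.toLp a) (hb.toLp b) = ∫ w in disc, b w * a w := by
  rw [L2.inner_def]
  refine integral_congr_ae ?_
  filter_upwards [ha.coeFn_toLp, hb.coeFn_toLp] with w h1 h2
  rw [h1, h2]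
  rfl

theorem integral_sub_sq_le {a b : E 2 → ℝ} (ha : MemLp a 2 μB) (hb : MemLp b 2 μB) :
    ∫ w in disc, (a w - b w) ^ 2 ≤ 2 * (∫ w in disc, a w ^ 2) + 2 * ∫ w in disc, b w ^ 2 := by
  rw [← integral_const_mul, ← integral_const_mul,
    ← integral_add (ha.integrable_sq.const_mul _) (hb.integrable_sq.const_mul _)]
  refine integral_mono (ha.sub hb).integrable_sq
    ((ha.integrable_sq.const_mul _).add (hb.integrable_sq.const_mul _)) fun w => ?_
  simp only
  nlinarith [sq_nonneg (a w + b w)]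

theorem HasWeakPartial.sub {i : Fin 2} {f g f' g' : E 2 → ℝ} (h : HasWeakPartial i f g)
    (h' : HasWeakPartial i f' g') :
    HasWeakPartial i (fun w => f w - f' w) (fun w => g w - g' w) := by
  have h1 := HasWeakPartial.sum (s := Finset.univ) (i := i) (f := ![f, fun w => -f' w])
    (g := ![g, fun w => -g' w]) (fun c _ => by
      fin_cases c
      · exact h
      · exact h'.clm (-ContinuousLinearMap.id ℝ ℝ))
  simpa [Fin.sum_univ_two, sub_eq_add_neg] using h1

/-- If the functions `s j ≥ 0` tend to zero in mean after localization by arbitrary cut-off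
functions, then a subsequence tends to zero almost everywhere. -/
theorem exists_subseq_ae_tendsto_zero {s : ℕ → E 2 → ℝ} (hs0 : ∀ j w, 0 ≤ s j w)
    (hsi : ∀ j, Integrable (s j) μB)
    (hs : ∀ η : E 2 → ℝ, ContDiff ℝ ∞ η → HasCompactSupport η → tsupport η ⊆ disc →
      Tendsto (fun j => ∫ w in disc, η w ^ 2 * s j w) atTop (𝓝 0)) :
    ∃ φ : ℕ → ℕ, StrictMono φ ∧ ∀ᵐ w ∂μB, Tendsto (fun j => s (φ j) w) atTop (𝓝 0) := by
  suffices h : TendstoInMeasure μB s atTop (fun _ => 0) by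
    exact h.exists_seq_tendsto_ae
  rw [tendstoInMeasure_iff_measureReal_norm]
  intro ε hε
  rw [Metric.tendsto_atTop]
  intro δ hδ
  -- Nothing is known near the boundary, but a boundary layer of small measure may be ignored for
  -- convergence in measure.
  obtain ⟨K, hKd, hK, hvol⟩ : ∃ K ⊆ disc, IsCompact K ∧ (μB).real Kᶜ < δ / 2 := by
    have hfin : volume disc ≠ ⊤ := measure_ball_lt_top.ne
    have hpos : 0 < volume disc := Metric.measure_ball_pos _ _ one_pos
    obtain ⟨K, hKd, hK, h1⟩ := isOpen_disc.exists_lt_isCompact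
      (ENNReal.sub_lt_self hfin hpos.ne' (ENNReal.ofReal_pos.2 (half_pos hδ)).ne')
    refine ⟨K, hKd, hK, ?_⟩
    have h2 : μB Kᶜ = volume disc - volume K := by
      rw [Measure.restrict_apply hK.measurableSet.compl, Set.inter_comm, ← Set.sdiff_eq,
        measure_sdiff hKd hK.measurableSet.nullMeasurableSet hK.measure_lt_top.ne]
    have h3 : volume disc - volume K < ENNReal.ofReal (δ / 2) := by
      refine ENNReal.sub_lt_of_lt_add (measure_mono hKd) ?_
      rw [add_comm]
      exact ENNReal.lt_add_of_sub_lt_right (Or.inl hfin) h1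
    rw [measureReal_def, h2]
    exact (ENNReal.lt_ofReal_iff_toReal_lt (ne_top_of_lt h3)).1 h3
  obtain ⟨r, hr1, hKr⟩ := exists_lt_subset_ball hK.isClosed hKd
  -- The maximum ensures a positive inner radius for the bump; its outer radius `(1 + r') / 2` lies
  -- strictly between `r'` and `1`.
  let r' : ℝ := max r (1 / 2)
  have hr' : r' < 1 := max_lt hr1 (by norm_num)
  have hr'0 : 0 < r' := lt_of_lt_of_le (by norm_num) (le_max_right _ _)
  let η : ContDiffBump (0 : E 2) := ⟨r', (1 + r') / 2, hr'0, by linarith⟩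
  have hη1 : ∀ w ∈ K, η w = 1 := fun w hw => η.one_of_mem_closedBall
    (Metric.closedBall_subset_closedBall (le_max_left _ _) (Metric.ball_subset_closedBall (hKr hw)))
  have hηd : tsupport η ⊆ disc := by
    rw [η.tsupport_eq]
    exact Metric.closedBall_subset_ball (show (1 + r') / 2 < 1 by linarith)
  obtain ⟨J, hJ⟩ := Metric.tendsto_atTop.1 (hs η η.contDiff η.hasCompactSupport hηd)
    (ε * (δ / 2)) (by positivity)
  refine ⟨J, fun j hj => ?_⟩
  have h1 := hJ j hj
  have hi0 : ∀ w, 0 ≤ η w ^ 2 * s j w := fun w => mul_nonneg (sq_nonneg _) (hs0 j w)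
  have hii : Integrable (fun w => η w ^ 2 * s j w) μB := by
    refine (hsi j).bdd_mul (c := 1) (η.continuous.pow 2).aestronglyMeasurable
      (ae_of_all _ fun w => ?_)
    rw [Real.norm_of_nonneg (sq_nonneg _)]
    exact pow_le_one₀ η.nonneg η.le_one
  rw [Real.dist_eq, sub_zero, abs_of_nonneg (integral_nonneg hi0)] at h1
  have h2 := mul_meas_ge_le_integral_of_nonneg (μ := μB) (ae_of_all _ hi0) hii ε
  have h3 : (μB).real {w | ε ≤ η w ^ 2 * s j w} < δ / 2 := by
    have := h2.trans_lt h1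
    exact lt_of_mul_lt_mul_left this hε.le
  have hsub : {w | ε ≤ ‖s j w - 0‖} ⊆ Kᶜ ∪ {w | ε ≤ η w ^ 2 * s j w} := by
    intro w hw
    by_cases hwK : w ∈ K
    · right
      rw [Set.mem_ofPred_eq, sub_zero, Real.norm_of_nonneg (hs0 j w)] at hw
      rw [Set.mem_ofPred_eq, hη1 w hwK]
      linarith
    · exact Or.inl hwK
  rw [Real.dist_eq, sub_zero, abs_of_nonneg measureReal_nonneg]
  calc (μB).real {w | ε ≤ ‖s j w - 0‖} ≤ (μB).real (Kᶜ ∪ {w | ε ≤ η w ^ 2 * s j w}) :=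
        measureReal_mono hsub
    _ ≤ (μB).real Kᶜ + (μB).real {w | ε ≤ η w ^ 2 * s j w} := measureReal_union_le _ _
    _ < δ := by linarith

/-- A bounded sequence in `H^{1,2}` has a subsequence that converges almost everywhere to a
function of class `H^{1,2}`, and the Dirichlet energy is lower semicontinuous. -/
theorem exists_subseq_ae_tendsto_memH12 {κ : Type*} [Fintype κ] {u : ℕ → κ → E 2 → ℝ} {C : ℝ}
    (hu : ∀ j c, MemH12 (u j c)) (bu : ∀ j c, ∫ w in disc, u j c w ^ 2 ≤ C)
    (bg : ∀ j c i, ∫ w in disc, weakPartial i (u j c) w ^ 2 ≤ C) :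
    ∃ φ : ℕ → ℕ, StrictMono φ ∧ ∃ a : κ → E 2 → ℝ, (∀ c, MemH12 (a c)) ∧
      (∀ᵐ w ∂μB, ∀ c, Tendsto (fun j => u (φ j) c w) atTop (𝓝 (a c w))) ∧
      ∀ d, Tendsto (fun j => ∑ i, ∑ c, ∫ w in disc, weakPartial i (u (φ j) c) w ^ 2) atTop (𝓝 d) →
        ∑ i, ∑ c, ∫ w in disc, weakPartial i (a c) w ^ 2 ≤ d := by
  have : Fact ((2 : ENNReal) ≠ ⊤) := ⟨by norm_num⟩
  have hg : ∀ j c i, MemLp (weakPartial i (u j c)) 2 μB := fun j c i => (hu j c).memLp_weakPartial i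
  -- `none` stands for the function and `some i` for its derivatives, so that one subsequence serves
  -- them all.
  let x : κ × Option (Fin 2) → ℕ → Lp ℝ 2 μB := fun c j =>
    c.2.elim ((hu j c.1).1.toLp _) fun i => (hg j c.1 i).toLp _
  have hx : ∀ c j, ‖x c j‖ ≤ √C := by
    rintro ⟨c, o⟩ j
    refine Real.le_sqrt_of_sq_le ?_
    cases o with
    | none => exact (norm_sq_toLp (hu j c).1).le.trans (bu j c)
    | some i => exact (norm_sq_toLp (hg j c i)).le.trans (bg j c i)
  obtain ⟨φ, hφ, hlim⟩ := exists_subseq_tendsto_inner_family Finset.univ hx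
  choose A hA using fun c => hlim c (Finset.mem_univ c)
  let a : κ → E 2 → ℝ := fun c => A (c, none)
  let b : κ → Fin 2 → E 2 → ℝ := fun c i => A (c, some i)
  have ha : ∀ c, MemLp (a c) 2 μB := fun c => Lp.memLp _
  have hb : ∀ c i, MemLp (b c i) 2 μB := fun c i => Lp.memLp _
  have hwa : ∀ c h, MemLp h 2 μB → Tendsto (fun j => ∫ w in disc, h w * u (φ j) c w) atTop
      (𝓝 (∫ w in disc, h w * a c w)) := by
    intro c h hh
    have h1 := hA (c, none) (hh.toLp h)
    have h2 : (A (c, none)) = (ha c).toLp (a c) := (Lp.toLp_coeFn _ _).symm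
    rw [h2, inner_toLp] at h1
    exact h1.congr fun j => inner_toLp (hu (φ j) c).1 hh
  have hwb : ∀ c i h, MemLp h 2 μB →
      Tendsto (fun j => ∫ w in disc, h w * weakPartial i (u (φ j) c) w) atTop
      (𝓝 (∫ w in disc, h w * b c i w)) := by
    intro c i h hh
    have h1 := hA (c, some i) (hh.toLp h)
    have h2 : (A (c, some i)) = (hb c i).toLp (b c i) := (Lp.toLp_coeFn _ _).symm
    rw [h2, inner_toLp] at h1
    exact h1.congr fun j => inner_toLp (hg (φ j) c i) hh
  -- The defining identity is linear in the function and its derivative, hence stable under weak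
  -- limits.
  have hab : ∀ c i, HasWeakPartial i (a c) (b c i) := by
    intro c i
    refine ⟨locallyIntegrableOn_of_memLp (ha c), locallyIntegrableOn_of_memLp (hb c i),
      fun ψ h1 h2 h3 => ?_⟩
    have h1' : ContDiff ℝ 1 ψ := h1.of_le (by exact_mod_cast le_top)
    have t1 := hwa c _ (memLp_of_continuousOn (continuous_fderiv_dir h1' i).continuousOn 2)
    have t2 := (hwb c i ψ (memLp_of_continuousOn h1.continuous.continuousOn 2)).neg
    refine tendsto_nhds_unique t1 (t2.congr fun j => ?_)
    exact (((hu (φ j) c).hasWeakPartial i).integral_eq ψ h1 h2 h3).symm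
  have haH : ∀ c, MemH12 (a c) := fun c => ⟨ha c, fun i => ⟨b c i, hab c i, hb c i⟩⟩
  -- strong local convergence
  have hloc : ∀ c, ∀ η : E 2 → ℝ, ContDiff ℝ ∞ η → HasCompactSupport η → tsupport η ⊆ disc →
      Tendsto (fun j => ∫ w in disc, (η w * (u (φ j) c w - a c w)) ^ 2) atTop (𝓝 0) := by
    intro c η h1 h2 h3
    let C' : ℝ := 2 * C + 2 * ((∫ w in disc, a c w ^ 2) + ∑ i, ∫ w in disc, b c i w ^ 2)
    have hsum : ∀ i, ∫ w in disc, b c i w ^ 2 ≤ ∑ i, ∫ w in disc, b c i w ^ 2 := fun i =>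
      Finset.single_le_sum (f := fun i => ∫ w in disc, b c i w ^ 2)
        (fun i _ => integral_nonneg fun w => sq_nonneg _) (Finset.mem_univ i)
    have hsum0 : 0 ≤ ∑ i, ∫ w in disc, b c i w ^ 2 :=
      Finset.sum_nonneg fun i _ => integral_nonneg fun w => sq_nonneg _
    have ha0 : 0 ≤ ∫ w in disc, a c w ^ 2 := integral_nonneg fun w => sq_nonneg _
    refine tendsto_integral_cutoff_sq (C := C') (v := fun j w => u (φ j) c w - a c w)
      (g := fun j i w => weakPartial i (u (φ j) c) w - b c i w)
      (fun j i => ((hu (φ j) c).hasWeakPartial i).sub (hab c i))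
      (fun j => (hu (φ j) c).1.sub (ha c)) (fun j i => (hg (φ j) c i).sub (hb c i))
      (fun j => ?_) (fun j i => ?_) (fun h hh => ?_) h1 h2 h3
    · refine (integral_sub_sq_le (hu (φ j) c).1 (ha c)).trans ?_
      have := bu (φ j) c
      simp only [C']
      linarith
    · refine (integral_sub_sq_le (hg (φ j) c i) (hb c i)).trans ?_
      have := bg (φ j) c i
      have := hsum i
      simp only [C']
      linarith
    · have := (hwa c h hh).sub_const (∫ w in disc, h w * a c w)
      rw [sub_self] at this
      refine this.congr fun j => ?_
      have i1 : Integrable (fun w => h w * u (φ j) c w) μB := hh.integrable_mul (hu (φ j) c).1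
      have i2 : Integrable (fun w => h w * a c w) μB := hh.integrable_mul (ha c)
      rw [← integral_sub i1 i2]
      simp only [mul_sub]
  have hsq : ∀ j c, Integrable (fun w => (u (φ j) c w - a c w) ^ 2) μB := fun j c =>
    ((hu (φ j) c).1.sub (ha c)).integrable_sq
  obtain ⟨ψ, hψ, hae⟩ := exists_subseq_ae_tendsto_zero
    (s := fun j w => ∑ c, (u (φ j) c w - a c w) ^ 2)
    (fun j w => Finset.sum_nonneg fun c _ => sq_nonneg _)
    (fun j => integrable_finsetSum _ fun c _ => hsq j c) (fun η h1 h2 h3 => by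
      have := tendsto_finsetSum Finset.univ fun c _ => hloc c η h1 h2 h3
      rw [Finset.sum_const_zero] at this
      refine this.congr fun j => ?_
      rw [← integral_finsetSum]
      · simp only [Finset.mul_sum, mul_pow]
      · exact fun c _ => (memLp_continuous_mul h1.continuous
          ((hu (φ j) c).1.sub (ha c))).integrable_sq)
  refine ⟨φ ∘ ψ, hφ.comp hψ, a, haH, ?_, fun d hd => ?_⟩
  · filter_upwards [hae] with w hw c
    have h1 : Tendsto (fun j => (u (φ (ψ j)) c w - a c w) ^ 2) atTop (𝓝 0) := by
      refine squeeze_zero (fun j => sq_nonneg _) (fun j => ?_) hw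
      exact Finset.single_le_sum (f := fun c => (u (φ (ψ j)) c w - a c w) ^ 2)
        (fun c _ => sq_nonneg _) (Finset.mem_univ c)
    have h2 : Tendsto (fun j => u (φ (ψ j)) c w - a c w) atTop (𝓝 0) := by
      have := h1.sqrt
      simp only [Real.sqrt_sq_eq_abs, Real.sqrt_zero] at this
      exact (tendsto_zero_iff_abs_tendsto_zero _).2 this
    simpa using h2.add_const (a c w)
  -- Lower semicontinuity from `2bg - b² ≤ g²`: the left-hand side is affine in `g`, and its weak
  -- limit is `b²`.
  · have hle : ∀ j, ∑ i, ∑ c, (2 * (∫ w in disc, b c i w * weakPartial i (u (φ (ψ j)) c) w) -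
        ∫ w in disc, b c i w ^ 2) ≤
        ∑ i, ∑ c, ∫ w in disc, weakPartial i (u (φ (ψ j)) c) w ^ 2 := by
      intro j
      refine Finset.sum_le_sum fun i _ => Finset.sum_le_sum fun c _ => ?_
      have i1 : Integrable (fun w => b c i w * weakPartial i (u (φ (ψ j)) c) w) μB :=
        (hb c i).integrable_mul (hg (φ (ψ j)) c i)
      have i2 := (hb c i).integrable_sq
      rw [← integral_const_mul, ← integral_sub (i1.const_mul 2) i2]
      refine integral_mono ((i1.const_mul 2).sub i2) (hg _ c i).integrable_sq fun w => ?_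
      have := sq_nonneg (b c i w - weakPartial i (u (φ (ψ j)) c) w)
      simp only
      linarith
    have hl : Tendsto (fun j => ∑ i, ∑ c,
        (2 * (∫ w in disc, b c i w * weakPartial i (u (φ (ψ j)) c) w) -
        ∫ w in disc, b c i w ^ 2)) atTop (𝓝 (∑ i, ∑ c, (2 * (∫ w in disc, b c i w * b c i w) -
        ∫ w in disc, b c i w ^ 2))) :=
      tendsto_finsetSum _ fun i _ => tendsto_finsetSum _ fun c _ =>
        (((hwb c i (b c i) (hb c i)).comp hψ.tendsto_atTop).const_mul 2).sub_const _
    have := le_of_tendsto_of_tendsto' hl hd hle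
    refine le_of_eq_of_le ?_ this
    refine Finset.sum_congr rfl fun i _ => Finset.sum_congr rfl fun c _ => ?_
    have e : ∫ w in disc, weakPartial i (a c) w ^ 2 = ∫ w in disc, b c i w ^ 2 :=
      integral_congr_ae (by filter_upwards [(hab c i).weakPartial_ae_eq] with w hw; rw [hw])
    rw [e]
    simp only [← sq]
    ring

/-! ### The direct method -/

section Minimizer

variable {n k : ℕ} {α : ℝ≥0} {X : E 2 → E (n + 2)}

theorem MemH12.clm {F G : Type*} [NormedAddCommGroup F] [NormedSpace ℝ F] [NormedAddCommGroup G]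
    [NormedSpace ℝ G] [CompleteSpace F] [CompleteSpace G] {f : E 2 → F} (h : MemH12 f)
    (T : F →L[ℝ] G) : MemH12 (fun w => T (f w)) :=
  ⟨T.comp_memLp' h.1, fun i => ⟨_, (h.hasWeakPartial i).clm T, T.comp_memLp' (h.memLp_weakPartial i)⟩⟩

theorem memH12_toLp {m : ℕ} {a : Fin m → E 2 → ℝ} (h : ∀ b, MemH12 (a b)) :
    MemH12 (fun w => (WithLp.toLp 2 (fun b => a b w) : E m)) := by
  have h1 : MemH12 fun w => ∑ b, (ContinuousLinearMap.toSpanSingleton ℝ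
      (EuclideanSpace.single b (1 : ℝ) : E m)) (a b w) :=
    MemH12.sum fun b _ => (h b).clm _
  refine h1.congr (ae_of_all _ fun w => ?_)
  ext c
  simp [Pi.single_apply]

/-- Brings the energy into the scalar form used by `exists_subseq_ae_tendsto_memH12`. -/
theorem dirichlet_eq_sum_components {N : Fin n → E 2 → E (n + 2)} (h : ∀ σ, MemH12 (N σ)) :
    dirichlet N = ∑ i, ∑ c : Fin n × Fin (n + 2),
      ∫ w in disc, weakPartial i (fun w => N c.1 w c.2) w ^ 2 := by
  rw [dirichlet]
  refine Finset.sum_congr rfl fun i _ => ?_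
  rw [Fintype.sum_prod_type]
  refine Finset.sum_congr rfl fun σ _ => ?_
  have hae : ∀ b, weakPartial i (fun w => N σ w b) =ᵐ[μB] fun w => weakPartial i (N σ) w b :=
    fun b => (((h σ).hasWeakPartial i).clm (EuclideanSpace.proj b)).weakPartial_ae_eq
  have hm : ∀ b, MemLp (fun w => weakPartial i (N σ) w b) 2 μB := fun b =>
    (EuclideanSpace.proj b : E (n + 2) →L[ℝ] ℝ).comp_memLp' ((h σ).memLp_weakPartial i)
  have e : ∀ b, ∫ w in disc, weakPartial i (fun w => N σ w b) w ^ 2 =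
      ∫ w in disc, weakPartial i (N σ) w b ^ 2 := fun b =>
    integral_congr_ae (by filter_upwards [hae b] with w hw; rw [hw])
  simp only [e]
  rw [← integral_finsetSum _ fun b _ => (hm b).integrable_sq]
  refine integral_congr_ae (ae_of_all _ fun w => ?_)
  simp [EuclideanSpace.norm_sq_eq]

theorem continuous_orientationDet (w : E 2) :
    Continuous fun v : Fin n → E (n + 2) => orientationDet X w v := by
  unfold orientationDet
  refine Continuous.matrix_det (continuous_matrix fun a b => ?_)
  refine Fin.cases ?_ (fun b => ?_) b
  · simpa using continuous_const
  · refine Fin.cases ?_ (fun b => ?_) b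
    · simpa using continuous_const
    · simp only [Matrix.of_apply, Matrix.cons_val_succ]
      exact (EuclideanSpace.proj a : E (n + 2) →L[ℝ] ℝ).continuous.comp (continuous_apply b)

theorem IsNormalBasisAt.of_tendsto (hX : IsImmersion k α X) (hc : IsConformal X) {w : E 2}
    (hw : w ∈ closedDisc) {v : ℕ → Fin n → E (n + 2)} {v₀ : Fin n → E (n + 2)}
    (h : ∀ j, IsNormalBasisAt X w (v j)) (hv : Tendsto v atTop (𝓝 v₀)) :
    IsNormalBasisAt X w v₀ := by
  have hσ : ∀ σ, Tendsto (fun j => v j σ) atTop (𝓝 (v₀ σ)) := fun σ => (tendsto_pi_nhds.1 hv) σ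
  rw [isNormalBasisAt_iff hX hc hw]
  refine ⟨?_, fun i σ => ?_, ?_⟩
  · rw [orthonormal_iff_ite]
    intro σ τ
    refine tendsto_nhds_unique ((hσ σ).inner (hσ τ)) ?_
    simp only [orthonormal_iff_ite.1 (h _).orthonormal]
    exact tendsto_const_nhds
  · refine tendsto_nhds_unique (tendsto_const_nhds.inner (hσ σ)) ?_
    simp only [(h _).inner_eq_zero]
    exact tendsto_const_nhds
  · exact ge_of_tendsto' (((continuous_orientationDet w).tendsto v₀).comp hv)
      fun j => (h j).oriented.le

theorem exists_dirichlet_minimizer (hX : IsImmersion k α X) (hc : IsConformal X)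
    (hne : ∃ N : Fin n → E 2 → E (n + 2), IsWeakNormalFrame X N) :
    ∃ N : Fin n → E 2 → E (n + 2), IsWeakNormalFrame X N ∧
      ∀ M, IsWeakNormalFrame X M → dirichlet N ≤ dirichlet M := by
  let S : Set ℝ := dirichlet '' {N : Fin n → E 2 → E (n + 2) | IsWeakNormalFrame X N}
  have hSne : S.Nonempty := by
    obtain ⟨N, hN⟩ := hne
    exact ⟨_, N, hN, rfl⟩
  have hSb : BddBelow S := by
    refine ⟨0, ?_⟩
    rintro _ ⟨N, -, rfl⟩
    exact Finset.sum_nonneg fun i _ => Finset.sum_nonneg fun σ _ =>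
      integral_nonneg fun w => sq_nonneg _
  obtain ⟨s, -, hs, hsS⟩ := exists_seq_tendsto_sInf hSne hSb
  choose N hN hNs using hsS
  obtain ⟨C, hC⟩ := hs.bddAbove_range
  have hC' : ∀ j, dirichlet (N j) ≤ C := fun j => by rw [hNs]; exact hC ⟨j, rfl⟩
  let u : ℕ → Fin n × Fin (n + 2) → E 2 → ℝ := fun j c w => N j c.1 w c.2
  have hu : ∀ j c, MemH12 (u j c) := fun j c =>
    ((hN j).memH12 c.1).clm (EuclideanSpace.proj c.2 : E (n + 2) →L[ℝ] ℝ)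
  -- Components of unit vectors are at most `1`, so the area of the disc suffices here; `C` is
  -- needed for the derivatives.
  have bu : ∀ j c, ∫ w in disc, u j c w ^ 2 ≤ max C ((μB).real Set.univ) := by
    intro j c
    have h1 : ∫ w in disc, u j c w ^ 2 ≤ ∫ _ in disc, (1 : ℝ) := by
      refine integral_mono_ae (hu j c).1.integrable_sq (integrable_const _) ?_
      filter_upwards [(hN j).ae_basis] with w hw
      have h2 := PiLp.norm_apply_le (N j c.1 w) c.2
      rw [hw.orthonormal.1 c.1, Real.norm_eq_abs] at h2
      exact (sq_le_one_iff_abs_le_one _).2 h2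
    refine h1.trans (le_trans ?_ (le_max_right _ _))
    simp [Measure.real]
  have bg : ∀ j c i, ∫ w in disc, weakPartial i (u j c) w ^ 2 ≤ max C ((μB).real Set.univ) := by
    intro j c i
    refine le_trans ?_ ((hC' j).trans (le_max_left _ _))
    rw [dirichlet_eq_sum_components (hN j).memH12]
    have h0 : ∀ i c, 0 ≤ ∫ w in disc, weakPartial i (u j c) w ^ 2 := fun i c =>
      integral_nonneg fun w => sq_nonneg _
    refine le_trans ?_ (Finset.single_le_sum (f := fun i => ∑ c,
      ∫ w in disc, weakPartial i (u j c) w ^ 2)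
      (fun i _ => Finset.sum_nonneg fun c _ => h0 i c) (Finset.mem_univ i))
    exact Finset.single_le_sum (f := fun c => ∫ w in disc, weakPartial i (u j c) w ^ 2)
      (fun c _ => h0 i c) (Finset.mem_univ c)
  obtain ⟨φ, hφ, a, ha, hae, hlsc⟩ := exists_subseq_ae_tendsto_memH12 hu bu bg
  let N' : Fin n → E 2 → E (n + 2) := fun σ w => WithLp.toLp 2 fun b => a (σ, b) w
  have hN'H : ∀ σ, MemH12 (N' σ) := fun σ => memH12_toLp fun b => ha (σ, b)
  have hN'w : IsWeakNormalFrame X N' := by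
    refine isWeakNormalFrame_of_memH12 hN'H ?_
    filter_upwards [hae, ae_all_iff.2 fun j => (hN j).ae_basis, ae_mem_disc] with w h1 h2 h3
    refine IsNormalBasisAt.of_tendsto hX hc (disc_subset_closedDisc h3) (fun j => h2 (φ j)) ?_
    rw [tendsto_pi_nhds]
    intro σ
    have h4 : Tendsto (fun j => (WithLp.toLp 2 fun b => u (φ j) (σ, b) w : E (n + 2))) atTop
        (𝓝 (N' σ w)) :=
      ((PiLp.continuous_toLp 2 _).tendsto _).comp (tendsto_pi_nhds.2 fun b => h1 (σ, b))
    exact h4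
  refine ⟨N', hN'w, fun M hM => ?_⟩
  have h1 : dirichlet N' ≤ sInf S := by
    rw [dirichlet_eq_sum_components hN'H]
    refine hlsc (sInf S) ((hs.comp hφ.tendsto_atTop).congr fun j => ?_)
    rw [Function.comp_apply, ← hNs, dirichlet_eq_sum_components (hN (φ j)).memH12]
  exact h1.trans (csInf_le hSb ⟨M, hM, rfl⟩)

end Minimizer

/-! ### The first variation -/

/-- Differentiation under the integral sign for the squared norm of a linear combination of
square integrable functions with coefficients depending smoothly on a parameter. -/
theorem differentiableAt_integral_norm_sq_sum {ι V : Type*} [Fintype ι] [NormedAddCommGroup V]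
    [InnerProductSpace ℝ V] {z : ι → E 2 → V} (hz : ∀ c, MemLp (z c) 2 μB)
    {p p' : ι → ℝ → E 2 → ℝ} {r K : ℝ} (hr : 0 < r)
    (hd : ∀ c, ∀ w ∈ disc, ∀ ε ∈ Metric.ball (0 : ℝ) r,
      HasDerivAt (fun ε => p c ε w) (p' c ε w) ε)
    (hp : ∀ c, ∀ w ∈ disc, ∀ ε ∈ Metric.ball (0 : ℝ) r, |p c ε w| ≤ K)
    (hp' : ∀ c, ∀ w ∈ disc, ∀ ε ∈ Metric.ball (0 : ℝ) r, |p' c ε w| ≤ K)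
    (hpm : ∀ c, ∀ ε ∈ Metric.ball (0 : ℝ) r, AEStronglyMeasurable (p c ε) μB)
    (hpm' : ∀ c, AEStronglyMeasurable (p' c 0) μB) :
    DifferentiableAt ℝ (fun ε => ∫ w in disc, ‖∑ c, p c ε w • z c w‖ ^ 2) 0 := by
  -- Both the sum and its derivative in `ε` have norm at most `K ∑ ‖z c‖`; Cauchy–Schwarz bounds the
  -- square of this, and the leading `2` comes from differentiating the squared norm.
  let bound : E 2 → ℝ := fun w => 2 * (K ^ 2 * (Fintype.card ι * ∑ c, ‖z c w‖ ^ 2))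
  have h0 : (0 : ℝ) ∈ Metric.ball (0 : ℝ) r := Metric.mem_ball_self hr
  have hzi : ∀ c, Integrable (fun w => ‖z c w‖ ^ 2) μB := fun c =>
    (hz c).integrable_norm_pow two_ne_zero
  have hbi : Integrable bound μB :=
    (((integrable_finsetSum _ fun c _ => hzi c).const_mul _).const_mul _).const_mul _
  have hle : ∀ {q : ι → ℝ} {w : E 2}, (∀ c, |q c| ≤ K) →
      ‖∑ c, q c • z c w‖ ≤ K * ∑ c, ‖z c w‖ := by
    intro q w hq
    rw [Finset.mul_sum]
    refine norm_sum_le_of_le _ fun c _ => ?_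
    rw [norm_smul]
    exact mul_le_mul_of_nonneg_right (hq c) (norm_nonneg _)
  have hcs : ∀ w, (∑ c, ‖z c w‖) ^ 2 ≤ Fintype.card ι * ∑ c, ‖z c w‖ ^ 2 := fun w =>
    sq_sum_le_card_mul_sum_sq
  have hSm : ∀ ε ∈ Metric.ball (0 : ℝ) r,
      AEStronglyMeasurable (fun w => ∑ c, p c ε w • z c w) μB := fun ε hε =>
    Finset.aestronglyMeasurable_fun_sum _ fun c _ => (hpm c ε hε).smul (hz c).1
  have hS'm : AEStronglyMeasurable (fun w => ∑ c, p' c 0 w • z c w) μB :=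
    Finset.aestronglyMeasurable_fun_sum _ fun c _ => (hpm' c).smul (hz c).1
  refine (hasDerivAt_integral_of_dominated_loc_of_deriv_le (μ := μB)
    (F := fun ε w => ‖∑ c, p c ε w • z c w‖ ^ 2)
    (F' := fun ε w => 2 * inner ℝ (∑ c, p c ε w • z c w) (∑ c, p' c ε w • z c w))
    (bound := bound) (Metric.ball_mem_nhds 0 hr) ?_ ?_ ?_ ?_ hbi ?_).2.differentiableAt
  · filter_upwards [Metric.ball_mem_nhds 0 hr] with ε hε
    exact ((hSm ε hε).norm.pow 2)
  · refine hbi.mono' ((hSm 0 h0).norm.pow 2) ?_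
    filter_upwards [ae_mem_disc] with w hw
    rw [Real.norm_of_nonneg (sq_nonneg _)]
    have h1 := pow_le_pow_left₀ (norm_nonneg _) (hle (w := w) fun c => hp c w hw 0 h0) 2
    have h2 := mul_le_mul_of_nonneg_left (hcs w) (sq_nonneg K)
    rw [mul_pow] at h1
    simp only [bound]
    linarith [sq_nonneg (‖∑ c, p c 0 w • z c w‖)]
  · exact ((hSm 0 h0).inner hS'm).const_mul 2
  · filter_upwards [ae_mem_disc] with w hw ε hε
    have h1 := hle (w := w) fun c => hp c w hw ε hε
    have h2 := hle (w := w) fun c => hp' c w hw ε hε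
    rw [norm_mul, Real.norm_two]
    have h3 := mul_le_mul_of_nonneg_left (hcs w) (sq_nonneg K)
    have h4 := norm_inner_le_norm (𝕜 := ℝ) (∑ c, p c ε w • z c w) (∑ c, p' c ε w • z c w)
    have h5 := mul_le_mul h1 h2 (norm_nonneg _) ((norm_nonneg _).trans h1)
    simp only [bound]
    nlinarith
  · filter_upwards [ae_mem_disc] with w hw ε hε
    have h1 : HasDerivAt (fun ε => ∑ c, p c ε w • z c w) (∑ c, p' c ε w • z c w) ε :=
      HasDerivAt.fun_sum fun c _ => (hd c w hw ε hε).smul_const _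
    exact h1.norm_sq

/-! ### Smoothness of rotation families in the parameter -/

section Family

variable {ε₀ : ℝ} {G : E 2 × ℝ → ℝ}

/-- The parameter domain of a rotation family. -/
def famDom (ε₀ : ℝ) : Set (E 2 × ℝ) := closedDisc ×ˢ Set.Ioo (-ε₀) ε₀

theorem uniqueDiffOn_famDom (ε₀ : ℝ) : UniqueDiffOn ℝ (famDom ε₀) :=
  uniqueDiffOn_closedDisc.prod isOpen_Ioo.uniqueDiffOn

theorem hasFDerivAt_of_famDom (hG : ContDiffOn ℝ ∞ G (famDom ε₀)) {w : E 2} (hw : w ∈ disc)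
    {ε : ℝ} (hε : ε ∈ Set.Ioo (-ε₀) ε₀) :
    HasFDerivAt G (fderivWithin ℝ G (famDom ε₀) (w, ε)) (w, ε) := by
  have hn : famDom ε₀ ∈ 𝓝 (w, ε) := prod_mem_nhds (closedDisc_mem_nhds hw) (isOpen_Ioo.mem_nhds hε)
  have h1 := (hG.contDiffAt hn).differentiableAt (by simp)
  rw [fderivWithin_of_mem_nhds hn]
  exact h1.hasFDerivAt

theorem hasDerivAt_of_famDom (hG : ContDiffOn ℝ ∞ G (famDom ε₀)) {w : E 2} (hw : w ∈ disc)
    {ε : ℝ} (hε : ε ∈ Set.Ioo (-ε₀) ε₀) :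
    HasDerivAt (fun ε => G (w, ε)) (fderivWithin ℝ G (famDom ε₀) (w, ε) (0, 1)) ε :=
  (hasFDerivAt_of_famDom hG hw hε).comp_hasDerivAt ε
    ((hasDerivAt_const ε w).prodMk (hasDerivAt_id ε))

theorem pd_of_famDom (hG : ContDiffOn ℝ ∞ G (famDom ε₀)) {w : E 2} (hw : w ∈ disc)
    {ε : ℝ} (hε : ε ∈ Set.Ioo (-ε₀) ε₀) (i : Fin 2) :
    pd (fun w => G (w, ε)) i w = fderivWithin ℝ G (famDom ε₀) (w, ε) (dir i, 0) := by
  have h1 : HasFDerivAt (fun w => G (w, ε)) ((fderivWithin ℝ G (famDom ε₀) (w, ε)).comp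
      ((ContinuousLinearMap.id ℝ (E 2)).prod 0)) w :=
    (hasFDerivAt_of_famDom hG hw hε).comp w ((hasFDerivAt_id w).prodMk (hasFDerivAt_const ε w))
  rw [pd_eq_fderiv hw, h1.fderiv]
  rfl

theorem contDiffOn_fderivWithin_famDom (hG : ContDiffOn ℝ ∞ G (famDom ε₀)) (v : E 2 × ℝ) :
    ContDiffOn ℝ ∞ (fun p => fderivWithin ℝ G (famDom ε₀) p v) (famDom ε₀) :=
  (hG.fderivWithin (uniqueDiffOn_famDom ε₀) (by simp)).clm_apply contDiffOn_const

theorem contDiffOn_slice (hG : ContDiffOn ℝ ∞ G (famDom ε₀)) {ε : ℝ}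
    (hε : ε ∈ Set.Ioo (-ε₀) ε₀) : ContDiffOn ℝ ∞ (fun w => G (w, ε)) closedDisc :=
  hG.comp (contDiff_id.prodMk contDiff_const).contDiffOn fun _ hw => ⟨hw, hε⟩

/-- `famDom ε₀` is not compact in the parameter, so the interval is halved to obtain a bound. -/
theorem exists_bound_famDom (hε₀ : 0 < ε₀) (hG : ContDiffOn ℝ ∞ G (famDom ε₀)) :
    ∃ K : ℝ, ∀ w ∈ disc, ∀ ε ∈ Metric.ball (0 : ℝ) (ε₀ / 2), |G (w, ε)| ≤ K := by
  have hsub : closedDisc ×ˢ Metric.closedBall (0 : ℝ) (ε₀ / 2) ⊆ famDom ε₀ := by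
    refine Set.prod_mono le_rfl fun ε hε => ?_
    rw [mem_closedBall_zero_iff, Real.norm_eq_abs, abs_le] at hε
    exact ⟨by linarith [hε.1], by linarith [hε.2]⟩
  obtain ⟨K, hK⟩ := (isCompact_closedDisc.prod
    (isCompact_closedBall (0 : ℝ) (ε₀ / 2))).exists_bound_of_continuousOn
    (hG.continuousOn.mono hsub)
  exact ⟨K, fun w hw ε hε =>
    hK (w, ε) ⟨disc_subset_closedDisc hw, Metric.ball_subset_closedBall hε⟩⟩

end Family

/-! ### Minimizers are Coulomb frames -/

section Coulomb

variable {n k : ℕ} {α : ℝ≥0} {X : E 2 → E (n + 2)}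

theorem weakPartial_rotate {N : Fin n → E 2 → E (n + 2)} (hN : ∀ σ, MemH12 (N σ))
    {R : E 2 → Matrix (Fin n) (Fin n) ℝ}
    (hR : ∀ σ ϑ, ContDiffOn ℝ 1 (fun w => R w σ ϑ) closedDisc) (i : Fin 2) (σ : Fin n) :
    weakPartial i (rotate R N σ) =ᵐ[μB] fun w =>
      ∑ ϑ, (pd (fun w => R w σ ϑ) i w • N ϑ w + R w σ ϑ • weakPartial i (N ϑ) w) :=
  (HasWeakPartial.sum fun ϑ _ => ((hN ϑ).hasWeakPartial i).smul (hR σ ϑ)).weakPartial_ae_eq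

theorem IsRotationFamily.isWeakNormalFrame_rotate (hX : IsImmersion k α X) (hc : IsConformal X)
    {N : Fin n → E 2 → E (n + 2)} (hN : IsWeakNormalFrame X N)
    {A : E 2 → Matrix (Fin n) (Fin n) ℝ} {ε₀ : ℝ} {R : ℝ → E 2 → Matrix (Fin n) (Fin n) ℝ}
    (hR : IsRotationFamily A ε₀ R) {ε : ℝ} (hε : ε ∈ Set.Ioo (-ε₀) ε₀) :
    IsWeakNormalFrame X (rotate (R ε) N) := by
  refine IsWeakNormalFrame.rotate hX hc hN.ae_basis (fun σ ϑ => ?_) ?_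
  · have h1 : ContDiffOn ℝ 1 (fun w => R ε w σ ϑ) closedDisc :=
      (contDiffOn_slice (hR.smooth σ ϑ) hε).of_le (by exact_mod_cast le_top)
    exact (hN.memH12 ϑ).bilin (ContinuousLinearMap.lsmul ℝ ℝ).flip h1
  · filter_upwards [ae_mem_disc] with w hw
    exact hR.mem_SO w (disc_subset_closedDisc hw) ε hε

/-- The Dirichlet energy along a rotation family is differentiable. -/
theorem IsRotationFamily.differentiableAt_dirichlet {N : Fin n → E 2 → E (n + 2)}
    (hN : ∀ σ, MemH12 (N σ)) {A : E 2 → Matrix (Fin n) (Fin n) ℝ} {ε₀ : ℝ}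
    {R : ℝ → E 2 → Matrix (Fin n) (Fin n) ℝ} (hR : IsRotationFamily A ε₀ R) :
    DifferentiableAt ℝ (fun ε => dirichlet (rotate (R ε) N)) 0 := by
  have hpos := hR.pos
  have hball : Metric.ball (0 : ℝ) (ε₀ / 2) ⊆ Set.Ioo (-ε₀) ε₀ := fun ε hε => by
    rw [mem_ball_zero_iff, Real.norm_eq_abs, abs_lt] at hε
    exact ⟨by linarith [hε.1], by linarith [hε.2]⟩
  let G : Fin n → Fin n → E 2 × ℝ → ℝ := fun σ ϑ p => R p.2 p.1 σ ϑ
  have hG : ∀ σ ϑ, ContDiffOn ℝ ∞ (G σ ϑ) (famDom ε₀) := hR.smooth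
  -- By the product rule the derivative of the rotated frame is a combination of the `N ϑ`, with
  -- coefficients the derivatives of `R`, and of the derivatives of the `N ϑ`, with coefficients
  -- `R`. The two halves of the sum type index these two groups.
  let P : Fin n → Fin 2 → Fin n ⊕ Fin n → E 2 × ℝ → ℝ := fun σ i c p =>
    Sum.elim (fun ϑ => fderivWithin ℝ (G σ ϑ) (famDom ε₀) p (dir i, 0)) (fun ϑ => G σ ϑ p) c
  have hP : ∀ σ i c, ContDiffOn ℝ ∞ (P σ i c) (famDom ε₀) := by
    rintro σ i (ϑ | ϑ)
    · exact contDiffOn_fderivWithin_famDom (hG σ ϑ) _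
    · exact hG σ ϑ
  let z : Fin 2 → Fin n ⊕ Fin n → E 2 → E (n + 2) := fun i c =>
    Sum.elim (fun ϑ => N ϑ) (fun ϑ => weakPartial i (N ϑ)) c
  have hz : ∀ i c, MemLp (z i c) 2 μB := by
    rintro i (ϑ | ϑ)
    · exact (hN ϑ).1
    · exact (hN ϑ).memLp_weakPartial i
  have hJ : ∀ i σ, DifferentiableAt ℝ
      (fun ε => ∫ w in disc, ‖∑ c, P σ i c (w, ε) • z i c w‖ ^ 2) 0 := by
    intro i σ
    choose K1 hK1 using fun c => exists_bound_famDom hpos (hP σ i c)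
    choose K2 hK2 using fun c =>
      exists_bound_famDom hpos (contDiffOn_fderivWithin_famDom (hP σ i c) (0, 1))
    let K : ℝ := ∑ c, (|K1 c| + |K2 c|)
    have hK : ∀ c, |K1 c| + |K2 c| ≤ K := fun c =>
      Finset.single_le_sum (f := fun c => |K1 c| + |K2 c|) (fun c _ => by positivity)
        (Finset.mem_univ c)
    refine differentiableAt_integral_norm_sq_sum (r := ε₀ / 2) (K := K)
      (p := fun c ε w => P σ i c (w, ε))
      (p' := fun c ε w => fderivWithin ℝ (P σ i c) (famDom ε₀) (w, ε) (0, 1))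
      (hz i) (half_pos hpos) (fun c w hw ε hε => hasDerivAt_of_famDom (hP σ i c) hw (hball hε))
      (fun c w hw ε hε => ?_) (fun c w hw ε hε => ?_) (fun c ε hε => ?_) (fun c => ?_)
    · linarith [hK1 c w hw ε hε, le_abs_self (K1 c), abs_nonneg (K2 c), hK c]
    · linarith [hK2 c w hw ε hε, le_abs_self (K2 c), abs_nonneg (K1 c), hK c]
    · exact aestronglyMeasurable_of_continuousOn
        (contDiffOn_slice (hP σ i c) (hball hε)).continuousOn
    · exact aestronglyMeasurable_of_continuousOn (contDiffOn_slice
        (contDiffOn_fderivWithin_famDom (hP σ i c) (0, 1))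
        (hball (Metric.mem_ball_self (half_pos hpos)))).continuousOn
  have hsum : DifferentiableAt ℝ (fun ε => ∑ i, ∑ σ,
      ∫ w in disc, ‖∑ c, P σ i c (w, ε) • z i c w‖ ^ 2) 0 :=
    DifferentiableAt.fun_sum fun i _ => DifferentiableAt.fun_sum fun σ _ => hJ i σ
  refine hsum.congr_of_eventuallyEq ?_
  filter_upwards [Metric.ball_mem_nhds 0 (half_pos hpos)] with ε hε
  refine Finset.sum_congr rfl fun i _ => Finset.sum_congr rfl fun σ _ => integral_congr_ae ?_
  have hsl : ∀ σ ϑ, ContDiffOn ℝ 1 (fun w => R ε w σ ϑ) closedDisc := fun σ ϑ =>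
    (contDiffOn_slice (hG σ ϑ) (hball hε)).of_le (by exact_mod_cast le_top)
  filter_upwards [weakPartial_rotate hN hsl i σ, ae_mem_disc] with w h1 h2
  rw [h1, Fintype.sum_sum_type, ← Finset.sum_add_distrib]
  congr 2
  refine Finset.sum_congr rfl fun ϑ _ => ?_
  congr 2
  exact pd_of_famDom (hG σ ϑ) h2 (hball hε) i

/-- A weak normal frame that minimizes the total torsion is a weak normal Coulomb frame. -/
theorem IsWeakNormalFrame.isWeakNormalCoulombFrame (hk : 3 ≤ k) (hX : IsImmersion k α X)
    (hc : IsConformal X) {N : Fin n → E 2 → E (n + 2)} (hN : IsWeakNormalFrame X N)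
    (hmin : ∀ M, IsWeakNormalFrame X M → dirichlet N ≤ dirichlet M) :
    IsWeakNormalCoulombFrame X N := by
  refine ⟨hN, fun A _ ε₀ R hR => ?_⟩
  have hI : Set.Ioo (-ε₀) ε₀ ∈ 𝓝 (0 : ℝ) := Ioo_mem_nhds (by linarith [hR.pos]) hR.pos
  have h0 : (0 : ℝ) ∈ Set.Ioo (-ε₀) ε₀ := mem_of_mem_nhds hI
  let f : ℝ → ℝ := fun ε => dirichlet (CoulombFrame.rotate (R ε) N)
  have hT : ∀ ε ∈ Set.Ioo (-ε₀) ε₀, totalTorsion X (CoulombFrame.rotate (R ε) N) =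
      f ε - ∫ w in disc, tangentialDensity X w := fun ε hε =>
    (hR.isWeakNormalFrame_rotate hX hc hN hε).totalTorsion_eq hk hX hc
  have hT0 : totalTorsion X (CoulombFrame.rotate (R 0) N) = totalTorsion X N := by
    refine totalTorsion_congr hk hX hc (hR.isWeakNormalFrame_rotate hX hc hN h0) hN ?_
    filter_upwards [ae_mem_disc] with w hw σ
    simp [CoulombFrame.rotate, hR.at_zero w (disc_subset_closedDisc hw), Matrix.one_apply]
  have hN0 := hN.totalTorsion_eq hk hX hc
  have hf0 : f 0 = dirichlet N := by
    have := hT 0 h0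
    rw [hT0, hN0] at this
    linarith
  -- Rotated frames are competitors, so `f` is minimal at `0` and Fermat's criterion applies; the
  -- difference quotients of torsion and energy coincide, the constant cancelling.
  have hlm : IsLocalMin f 0 := by
    filter_upwards [hI] with ε hε
    rw [hf0]
    exact hmin _ (hR.isWeakNormalFrame_rotate hX hc hN hε)
  have hd := (hR.differentiableAt_dirichlet hN.memH12).hasDerivAt
  rw [hlm.hasDerivAt_eq_zero hd, hasDerivAt_iff_tendsto_slope] at hd
  refine hd.congr' ?_
  filter_upwards [mem_nhdsWithin_of_mem_nhds hI] with ε hε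
  rw [hT ε hε, hN0, ← hf0]
  simp [slope, f]

end Coulomb

/-! ### Existence of a frame of class `C¹` -/

section Rotor

variable {V : Type*} [NormedAddCommGroup V] [InnerProductSpace ℝ V]

/-- The rotation in the plane of the unit vectors `a` and `c` that maps `a` to `c`. -/
def rotor (a c x : V) : V :=
  x - (inner ℝ (a + c) x / (1 + inner ℝ a c)) • (a + c) + (2 * inner ℝ a x) • c

/-- `rotor a c` is the reflection in the hyperplane orthogonal to `a` followed by that in the
hyperplane orthogonal to `a + c`. For unit vectors it is rational in `a` and `c`, the only
singularity being `c = -a`. -/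
theorem inner_rotor {a c : V} (ha : ‖a‖ = 1) (hc : ‖c‖ = 1) (h : 1 + inner ℝ a c ≠ 0) (x y : V) :
    inner ℝ (rotor a c x) (rotor a c y) = inner ℝ x y := by
  have haa : inner ℝ a a = (1 : ℝ) := by rw [real_inner_self_eq_norm_sq, ha, one_pow]
  have hcc : inner ℝ c c = (1 : ℝ) := by rw [real_inner_self_eq_norm_sq, hc, one_pow]
  have e1 := real_inner_comm a c
  have e2 := real_inner_comm a x
  have e3 := real_inner_comm c x
  simp only [rotor, inner_add_left, inner_add_right, inner_sub_left, inner_sub_right,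
    real_inner_smul_left, real_inner_smul_right, haa, hcc, e1, ← e2, ← e3]
  simp only [real_inner_comm a x, real_inner_comm c x] at h ⊢
  field_simp
  ring

theorem rotor_self {a c : V} (ha : ‖a‖ = 1) (h : 1 + inner ℝ a c ≠ 0) : rotor a c a = c := by
  have haa : inner ℝ a a = (1 : ℝ) := by rw [real_inner_self_eq_norm_sq, ha, one_pow]
  have h1 : inner ℝ (a + c) a / (1 + inner ℝ a c) = (1 : ℝ) := by
    rw [inner_add_left, haa, real_inner_comm a c, div_self h]
  rw [rotor, h1, haa, one_smul, mul_one, two_smul]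
  abel

theorem rotor_of_orthogonal {a c x : V} (h1 : inner ℝ a x = 0) (h2 : inner ℝ c x = 0) :
    rotor a c x = x := by
  simp [rotor, inner_add_left, h1, h2]

theorem norm_rotor {a c : V} (ha : ‖a‖ = 1) (hc : ‖c‖ = 1) (h : 1 + inner ℝ a c ≠ 0) (x : V) :
    ‖rotor a c x‖ = ‖x‖ := by
  have := inner_rotor ha hc h x x
  rw [real_inner_self_eq_norm_sq, real_inner_self_eq_norm_sq] at this
  exact (pow_left_inj₀ (norm_nonneg _) (norm_nonneg _) two_ne_zero).1 this

theorem one_add_inner_pos {a c : V} (ha : ‖a‖ = 1) (hc : ‖c‖ = 1) (h : ‖a - c‖ ≤ 1) :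
    1 / 2 ≤ inner ℝ a c := by
  have := norm_sub_sq_real a c
  rw [ha, hc] at this
  nlinarith [norm_nonneg (a - c)]

/-- Keeps the second vector of a pair close to its old position after the first has been rotated, so
that a second rotor is defined. The factor `2` bounds `‖a + c‖`. -/
theorem norm_rotor_sub_le {a c x : V} (ha : ‖a‖ = 1) (hc : ‖c‖ = 1) (hac : ‖a - c‖ ≤ 1)
    (hx : ‖x‖ = 1) (h : inner ℝ a x = 0) : ‖rotor a c x - x‖ ≤ 2 * ‖a - c‖ := by
  have hs := one_add_inner_pos ha hc hac
  have h1 : rotor a c x - x = - ((inner ℝ (c - a) x / (1 + inner ℝ a c)) • (a + c)) := by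
    rw [rotor, inner_add_left, inner_sub_left, h]
    simp
  rw [h1, norm_neg, norm_smul, Real.norm_eq_abs, abs_div,
    abs_of_pos (show (0 : ℝ) < 1 + inner ℝ a c by linarith)]
  have h2 : |inner ℝ (c - a) x| ≤ ‖a - c‖ := by
    refine (abs_real_inner_le_norm _ _).trans ?_
    rw [hx, mul_one, norm_sub_rev]
  have h3 : ‖a + c‖ ≤ 2 := (norm_add_le _ _).trans (by rw [ha, hc]; norm_num)
  have h4 : |inner ℝ (c - a) x| / (1 + inner ℝ a c) ≤ ‖a - c‖ :=
    (div_le_self (abs_nonneg _) (by linarith)).trans h2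
  calc _ ≤ ‖a - c‖ * 2 := mul_le_mul h4 h3 (norm_nonneg _) (norm_nonneg _)
    _ = _ := mul_comm _ _

theorem contDiffOn_rotor {s : Set (E 2)} {a c x : E 2 → V} (ha : ContDiffOn ℝ 1 a s)
    (hc : ContDiffOn ℝ 1 c s) (hx : ContDiffOn ℝ 1 x s)
    (h : ∀ w ∈ s, 1 + inner ℝ (a w) (c w) ≠ 0) :
    ContDiffOn ℝ 1 (fun w => rotor (a w) (c w) (x w)) s :=
  (hx.sub ((((ha.add hc).inner ℝ hx).div (contDiffOn_const.add (ha.inner ℝ hc)) h).smul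
    (ha.add hc))).add ((contDiffOn_const.mul (ha.inner ℝ hx)).smul hc)

/-- Transport of vector fields orthogonal to an orthonormal pair `a, b` to vector fields
orthogonal to a nearby orthonormal pair `c, d`. -/
theorem exists_transport {s : Set (E 2)} {a b c d : E 2 → V} (ha : ContDiffOn ℝ 1 a s)
    (hb : ContDiffOn ℝ 1 b s) (hc : ContDiffOn ℝ 1 c s) (hd : ContDiffOn ℝ 1 d s)
    (ha1 : ∀ w ∈ s, ‖a w‖ = 1) (hb1 : ∀ w ∈ s, ‖b w‖ = 1) (hc1 : ∀ w ∈ s, ‖c w‖ = 1)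
    (hd1 : ∀ w ∈ s, ‖d w‖ = 1) (hab : ∀ w ∈ s, inner ℝ (a w) (b w) = 0)
    (hcd : ∀ w ∈ s, inner ℝ (c w) (d w) = 0) (hac : ∀ w ∈ s, ‖a w - c w‖ ≤ 1 / 4)
    (hbd : ∀ w ∈ s, ‖b w - d w‖ ≤ 1 / 4) :
    ∃ T : E 2 → V → V, (∀ x : E 2 → V, ContDiffOn ℝ 1 x s → ContDiffOn ℝ 1 (fun w => T w (x w)) s) ∧
      (∀ w ∈ s, ∀ x y, inner ℝ (T w x) (T w y) = inner ℝ x y) ∧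
      (∀ w ∈ s, T w (a w) = c w) ∧ ∀ w ∈ s, T w (b w) = d w := by
  have h1 : ∀ w ∈ s, 1 + inner ℝ (a w) (c w) ≠ 0 := fun w hw => by
    have := one_add_inner_pos (ha1 w hw) (hc1 w hw) ((hac w hw).trans (by norm_num))
    linarith
  -- One rotor takes `a` to `c` and `b` to `b'`; a second takes `b'` to `d`. Both `b'` and `d` are
  -- orthogonal to `c`, so the second rotor fixes `c`.
  let b' : E 2 → V := fun w => rotor (a w) (c w) (b w)
  have hb' : ContDiffOn ℝ 1 b' s := contDiffOn_rotor ha hc hb h1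
  have hb'1 : ∀ w ∈ s, ‖b' w‖ = 1 := fun w hw => by
    simp only [b']
    rw [norm_rotor (ha1 w hw) (hc1 w hw) (h1 w hw), hb1 w hw]
  have h2 : ∀ w ∈ s, 1 + inner ℝ (b' w) (d w) ≠ 0 := fun w hw => by
    have h3 := norm_rotor_sub_le (ha1 w hw) (hc1 w hw) ((hac w hw).trans (by norm_num)) (hb1 w hw)
      (hab w hw)
    -- The distance is at most `2 · 1/4 + 1/4`.
    have h4 : ‖b' w - d w‖ ≤ 1 := by
      have h5 := norm_sub_le_norm_sub_add_norm_sub (b' w) (b w) (d w)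
      have := hac w hw
      have := hbd w hw
      simp only [b'] at h5 ⊢
      linarith
    have := one_add_inner_pos (hb'1 w hw) (hd1 w hw) h4
    linarith
  refine ⟨fun w x => rotor (b' w) (d w) (rotor (a w) (c w) x), fun x hx =>
    contDiffOn_rotor hb' hd (contDiffOn_rotor ha hc hx h1) h2, fun w hw x y => ?_, fun w hw => ?_,
    fun w hw => rotor_self (hb'1 w hw) (h2 w hw)⟩
  · rw [inner_rotor (hb'1 w hw) (hd1 w hw) (h2 w hw),
      inner_rotor (ha1 w hw) (hc1 w hw) (h1 w hw)]
  · have h3 := rotor_self (ha1 w hw) (h1 w hw)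
    change rotor (b' w) (d w) (rotor (a w) (c w) (a w)) = c w
    rw [h3]
    refine rotor_of_orthogonal ?_ ?_
    · have := inner_rotor (ha1 w hw) (hc1 w hw) (h1 w hw) (b w) (a w)
      rwa [h3, real_inner_comm (a w), hab w hw] at this
    · rw [real_inner_comm, hcd w hw]

end Rotor

/-! ### Construction of a global normal frame -/

section Existence

variable {n k : ℕ} {α : ℝ≥0} {X : E 2 → E (n + 2)}

/-- The normalized coordinate tangent vectors. -/
def unitTangent (X : E 2 → E (n + 2)) (i : Fin 2) (w : E 2) : E (n + 2) :=
  (√(confFactor X w))⁻¹ • tangentVec X i w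

theorem inner_unitTangent (hX : IsImmersion k α X) (hc : IsConformal X) {w : E 2}
    (hw : w ∈ closedDisc) (i j : Fin 2) :
    inner ℝ (unitTangent X i w) (unitTangent X j w) = if i = j then 1 else 0 := by
  have hp := confFactor_pos hX hw
  rw [unitTangent, unitTangent, real_inner_smul_left, real_inner_smul_right,
    inner_tangentVec hc hw]
  split_ifs
  · rw [← mul_assoc, ← mul_inv, Real.mul_self_sqrt hp.le, inv_mul_cancel₀ hp.ne']
  · simp

theorem contDiffOn_unitTangent (hk : 3 ≤ k) (hX : IsImmersion k α X) (i : Fin 2) :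
    ContDiffOn ℝ 1 (unitTangent X i) closedDisc := by
  have ht : ∀ i, ContDiffOn ℝ 1 (tangentVec X i) closedDisc := fun i =>
    (contDiffOn_tangentVec hk hX i).of_le one_le_two
  have hcf : ContDiffOn ℝ 1 (confFactor X) closedDisc := (ht 0).inner ℝ (ht 0)
  exact ((hcf.sqrt fun w hw => (confFactor_pos hX hw).ne').inv
    fun w hw => (Real.sqrt_pos.2 (confFactor_pos hX hw)).ne').smul (ht i)

theorem exists_orthonormal_normal (hX : IsImmersion k α X) {w : E 2} (hw : w ∈ closedDisc) :
    ∃ v : Fin n → E (n + 2), Orthonormal ℝ v ∧ ∀ i σ, inner ℝ (tangentVec X i w) (v σ) = 0 := by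
  have h1 : Module.finrank ℝ (Submodule.span ℝ (Set.range fun i : Fin 2 => tangentVec X i w)) = 2 := by
    rw [finrank_span_eq_card (hX.2 w hw)]
    simp
  have h2 := Submodule.finrank_add_finrank_orthogonal
    (Submodule.span ℝ (Set.range fun i : Fin 2 => tangentVec X i w))
  have h3 : Module.finrank ℝ (normalSpace X w) = n := by
    rw [h1, finrank_euclideanSpace_fin] at h2
    rw [normalSpace]
    omega
  let b := (stdOrthonormalBasis ℝ (normalSpace X w)).reindex (finCongr h3)
  refine ⟨fun σ => b σ, b.orthonormal.comp_linearIsometry (normalSpace X w).subtypeₗᵢ,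
    fun i σ => inner_tangentVec_eq_zero (b σ).2 i⟩

theorem smul_mem_closedDisc {t : ℝ} (h0 : 0 ≤ t) (h1 : t ≤ 1) {w : E 2} (hw : w ∈ closedDisc) :
    t • w ∈ closedDisc := by
  rw [closedDisc, mem_closedBall_zero_iff] at hw ⊢
  rw [norm_smul, Real.norm_of_nonneg h0]
  exact mul_le_one₀ h1 (norm_nonneg _) hw

/-- The disc contracts to its centre, so the normal bundle is trivial. The pull-backs of the tangent
frame by `w ↦ (j/m) w` lead from the constant frame at the origin to the actual one in steps small
enough for `exists_transport`. -/
theorem exists_orthonormal_normal_field (hk : 3 ≤ k) (hX : IsImmersion k α X)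
    (hc : IsConformal X) :
    ∃ N : Fin n → E 2 → E (n + 2), (∀ σ, ContDiffOn ℝ 1 (N σ) closedDisc) ∧
      ∀ w ∈ closedDisc, Orthonormal ℝ (fun σ => N σ w) ∧
        ∀ i σ, inner ℝ (tangentVec X i w) (N σ w) = 0 := by
  have hp := contDiffOn_unitTangent hk hX
  obtain ⟨δ, hδ, hunif⟩ : ∃ δ > 0, ∀ i, ∀ w ∈ closedDisc, ∀ w' ∈ closedDisc, dist w w' < δ →
      ‖unitTangent X i w - unitTangent X i w'‖ ≤ 1 / 4 := by
    have hu : ∀ i, ∃ δ > 0, ∀ w ∈ closedDisc, ∀ w' ∈ closedDisc, dist w w' < δ →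
        dist (unitTangent X i w) (unitTangent X i w') < 1 / 4 := fun i =>
      Metric.uniformContinuousOn_iff.1
        (isCompact_closedDisc.uniformContinuousOn_of_continuous (hp i).continuousOn) (1 / 4)
        (by norm_num)
    obtain ⟨δ0, h00, h01⟩ := hu 0
    obtain ⟨δ1, h10, h11⟩ := hu 1
    refine ⟨min δ0 δ1, lt_min h00 h10, fun i w hw w' hw' hd => ?_⟩
    rw [← dist_eq_norm]
    fin_cases i
    · exact (h01 w hw w' hw' (hd.trans_le (min_le_left _ _))).le
    · exact (h11 w hw w' hw' (hd.trans_le (min_le_right _ _))).le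
  -- Consecutive points `(j/m) w` then lie closer than `δ`, the modulus belonging to `1/4`.
  obtain ⟨m, hm⟩ := exists_nat_gt (1 / δ)
  have hm0 : (0 : ℝ) < m := (by positivity : (0 : ℝ) < 1 / δ).trans hm
  have key : ∀ j : ℕ, j ≤ m → ∃ N : Fin n → E 2 → E (n + 2),
      (∀ σ, ContDiffOn ℝ 1 (N σ) closedDisc) ∧
      ∀ w ∈ closedDisc, Orthonormal ℝ (fun σ => N σ w) ∧
        ∀ i σ, inner ℝ (unitTangent X i (((j : ℝ) / m) • w)) (N σ w) = 0 := by
    intro j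
    induction j with
    | zero =>
      intro _
      obtain ⟨v, hv, hn⟩ := exists_orthonormal_normal hX
        (show (0 : E 2) ∈ closedDisc by simp [closedDisc])
      refine ⟨fun σ _ => v σ, fun σ => contDiffOn_const, fun w _ => ⟨hv, fun i σ => ?_⟩⟩
      simp [unitTangent, real_inner_smul_left, hn]
    | succ j ih =>
      intro hj
      obtain ⟨N, hN, hNw⟩ := ih (by omega)
      have hjm : ∀ l : ℕ, l ≤ m → ∀ w ∈ closedDisc, ((l : ℝ) / m) • w ∈ closedDisc :=
        fun l hl w hw => smul_mem_closedDisc (by positivity)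
          ((div_le_one hm0).2 (by exact_mod_cast hl)) hw
      have hcomp : ∀ l : ℕ, l ≤ m → ∀ i,
          ContDiffOn ℝ 1 (fun w => unitTangent X i (((l : ℝ) / m) • w)) closedDisc :=
        fun l hl i => (hp i).comp (contDiff_const_smul _).contDiffOn (hjm l hl)
      have hone : ∀ l : ℕ, l ≤ m → ∀ i, ∀ w ∈ closedDisc,
          ‖unitTangent X i (((l : ℝ) / m) • w)‖ = 1 := fun l hl i w hw => by
        have := inner_unitTangent hX hc (hjm l hl w hw) i i
        rw [if_pos rfl, real_inner_self_eq_norm_sq] at this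
        exact (pow_eq_one_iff_of_nonneg (norm_nonneg _) two_ne_zero).1 this
      have hperp : ∀ l : ℕ, l ≤ m → ∀ w ∈ closedDisc,
          inner ℝ (unitTangent X 0 (((l : ℝ) / m) • w)) (unitTangent X 1 (((l : ℝ) / m) • w)) = 0 :=
        fun l hl w hw => by simpa using inner_unitTangent hX hc (hjm l hl w hw) 0 1
      have hclose : ∀ i, ∀ w ∈ closedDisc, ‖unitTangent X i (((j : ℝ) / m) • w) -
          unitTangent X i ((((j + 1 : ℕ) : ℝ) / m) • w)‖ ≤ 1 / 4 := fun i w hw => by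
        refine hunif i _ (hjm j (by omega) w hw) _ (hjm (j + 1) hj w hw) ?_
        rw [dist_eq_norm, ← sub_smul, norm_smul, ← sub_div]
        have hw1 : ‖w‖ ≤ 1 := mem_closedBall_zero_iff.1 hw
        have : ‖((j : ℝ) - ((j + 1 : ℕ) : ℝ)) / m‖ = 1 / m := by
          push_cast
          rw [sub_add_cancel_left, norm_div, norm_neg, norm_one, Real.norm_of_nonneg hm0.le]
        rw [this]
        have h1 : 1 / (m : ℝ) < δ := by
          rw [div_lt_iff₀ hm0]
          rw [div_lt_iff₀ hδ] at hm
          linarith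
        have : 1 / (m : ℝ) * ‖w‖ ≤ 1 / m := mul_le_of_le_one_right (by positivity) hw1
        linarith
      obtain ⟨T, hT1, hT2, hT3, hT4⟩ := exists_transport (hcomp j (by omega) 0)
        (hcomp j (by omega) 1) (hcomp (j + 1) hj 0) (hcomp (j + 1) hj 1) (hone j (by omega) 0)
        (hone j (by omega) 1) (hone (j + 1) hj 0) (hone (j + 1) hj 1) (hperp j (by omega))
        (hperp (j + 1) hj) (hclose 0) (hclose 1)
      refine ⟨fun σ w => T w (N σ w), fun σ => hT1 _ (hN σ), fun w hw => ⟨?_, fun i σ => ?_⟩⟩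
      · rw [orthonormal_iff_ite]
        intro σ τ
        rw [hT2 w hw]
        exact orthonormal_iff_ite.1 (hNw w hw).1 σ τ
      · fin_cases i
        · have := hT3 w hw
          simp only [Fin.zero_eta]
          rw [← this, hT2 w hw]
          exact (hNw w hw).2 0 σ
        · have := hT4 w hw
          simp only [Fin.mk_one]
          rw [← this, hT2 w hw]
          exact (hNw w hw).2 1 σ
  obtain ⟨N, hN, hNw⟩ := key m le_rfl
  refine ⟨N, hN, fun w hw => ⟨(hNw w hw).1, fun i σ => ?_⟩⟩
  have h1 := (hNw w hw).2 i σ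
  rw [div_self hm0.ne', one_smul, unitTangent, real_inner_smul_left] at h1
  exact (mul_eq_zero.1 h1).resolve_left
    (inv_ne_zero (Real.sqrt_pos.2 (confFactor_pos hX hw)).ne')

/-- The orientation determinant is continuous and nowhere zero on a connected set, so it has a
constant sign. If that sign is negative, reversing one vector corrects it, which is possible because
`n ≥ 1`. -/
theorem exists_weakNormalFrame (hn : 1 ≤ n) (hk : 3 ≤ k) (hX : IsImmersion k α X)
    (hc : IsConformal X) : ∃ N : Fin n → E 2 → E (n + 2), IsWeakNormalFrame X N := by
  obtain ⟨N, hN, hNw⟩ := exists_orthonormal_normal_field hk hX hc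
  have hcont : ContinuousOn (fun w => orientationDet X w fun σ => N σ w) closedDisc := by
    unfold orientationDet
    refine continuous_id.matrix_det.comp_continuousOn
      (continuousOn_pi.2 fun a => continuousOn_pi.2 fun b => ?_)
    have hpr : ∀ {f : E 2 → E (n + 2)}, ContinuousOn f closedDisc →
        ContinuousOn (fun w => f w a) closedDisc := fun hf =>
      (EuclideanSpace.proj a : E (n + 2) →L[ℝ] ℝ).continuous.comp_continuousOn hf
    refine Fin.cases ?_ (fun b => ?_) b
    · simpa using hpr (contDiffOn_tangentVec hk hX 0).continuousOn
    · refine Fin.cases ?_ (fun b => ?_) b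
      · simpa using hpr (contDiffOn_tangentVec hk hX 1).continuousOn
      · simpa using hpr (hN b).continuousOn
  have hne : ∀ w ∈ closedDisc, (orientationDet X w fun σ => N σ w) ≠ 0 := fun w hw =>
    orientationDet_ne_zero hX hc hw (hNw w hw).1 (hNw w hw).2
  have h0 : (0 : E 2) ∈ closedDisc := by simp [closedDisc]
  have hpre : IsPreconnected closedDisc := (convex_closedBall _ _).isPreconnected
  suffices h : ∃ q : Fin n → ℝ, (∀ σ, q σ * q σ = 1) ∧
      ∀ w ∈ closedDisc, 0 ≤ (∏ σ, q σ) * orientationDet X w fun σ => N σ w by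
    obtain ⟨q, hq, hpos⟩ := h
    refine ⟨fun σ w => q σ • N σ w, isWeakNormalFrame_of_memH12
      (fun σ => ContDiffOn.memH12 ((hN σ).const_smul (q σ))) ?_⟩
    filter_upwards [ae_mem_disc] with w hwd
    have hw := disc_subset_closedDisc hwd
    rw [isNormalBasisAt_iff hX hc hw]
    refine ⟨?_, fun i σ => ?_, ?_⟩
    · rw [orthonormal_iff_ite]
      intro σ τ
      rw [real_inner_smul_left, real_inner_smul_right, orthonormal_iff_ite.1 (hNw w hw).1 σ τ]
      split_ifs with hστ
      · rw [hστ, mul_one, hq]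
      · simp
    · rw [real_inner_smul_right, (hNw w hw).2, mul_zero]
    · have h1 := orientationDet_rotate (X := X) (w := w) (fun σ => N σ w) (Matrix.diagonal q)
      have h2 : (fun σ => ∑ ϑ, Matrix.diagonal q σ ϑ • N ϑ w) = fun σ => q σ • N σ w := by
        funext σ
        rw [Finset.sum_eq_single σ] <;> simp +contextual [eq_comm]
      rw [h2, Matrix.det_diagonal] at h1
      rw [h1]
      exact hpos w hw
  rcases lt_or_gt_of_ne (hne 0 h0) with hlt | hgt
  · refine ⟨fun σ => if σ = ⟨0, hn⟩ then -1 else 1, fun σ => by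
      simp only
      split_ifs <;> norm_num,
      fun w hw => ?_⟩
    rw [Finset.prod_ite_eq' Finset.univ (⟨0, hn⟩ : Fin n) fun _ => (-1 : ℝ)]
    simp only [Finset.mem_univ, if_true, neg_one_mul, Left.nonneg_neg_iff]
    by_contra hcon
    obtain ⟨w', hw', h'⟩ := hpre.intermediate_value h0 hw hcont ⟨hlt.le, (not_le.1 hcon).le⟩
    exact hne w' hw' h'
  · refine ⟨fun _ => 1, fun σ => by norm_num, fun w hw => ?_⟩
    rw [Finset.prod_const_one, one_mul]
    by_contra hcon
    obtain ⟨w', hw', h'⟩ := hpre.intermediate_value hw h0 hcont ⟨(not_le.1 hcon).le, hgt.le⟩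
    exact hne w' hw' h'

end Existence

end CoulombFrame

end

/-! ### The main theorem -/

open CoulombFrame
theorem mainTheorem6 (n k : ℕ) (hn : 1 ≤ n) (hk : 3 ≤ k) (α : ℝ≥0) (hα₀ : 0 < α) (hα₁ : α < 1)
    (X : E 2 → E (n + 2)) (hX : IsImmersion k α X) (hconf : IsConformal X) :
    ∃ N : Fin n → E 2 → E (n + 2),
      IsWeakNormalCoulombFrame X N ∧
      (∀ M : Fin n → E 2 → E (n + 2), IsWeakNormalFrame X M →
        totalTorsion X N ≤ totalTorsion X M) ∧
      (∀ N₀ : Fin n → E 2 → E (n + 2), IsNormalFrame (k - 1) α X N₀ →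
        ∃ R : E 2 → Matrix (Fin n) (Fin n) ℝ, MemH12SO R ∧
          (∀ᵐ w ∂(volume.restrict disc), ∀ σ, N σ w = rotate R N₀ σ w) ∧
          ∀ Q : E 2 → Matrix (Fin n) (Fin n) ℝ, MemH12SO Q →
            totalTorsion X (rotate R N₀) ≤ totalTorsion X (rotate Q N₀)) := by
  obtain ⟨N, hN, hmin⟩ := exists_dirichlet_minimizer hX hconf
    (exists_weakNormalFrame hn hk hX hconf)
  have hT : ∀ M, IsWeakNormalFrame X M → totalTorsion X N ≤ totalTorsion X M := fun M hM => by
    rw [hN.totalTorsion_eq hk hX hconf, hM.totalTorsion_eq hk hX hconf]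
    linarith [hmin M hM]
  refine ⟨N, hN.isWeakNormalCoulombFrame hk hX hconf hmin, hT, fun N₀ hN₀ => ?_⟩
  have h1 : ∀ σ, ContDiffOn ℝ 1 (N₀ σ) closedDisc := fun σ =>
    (hN₀.1 σ).1.of_le (by exact_mod_cast (by omega : 1 ≤ k - 1))
  obtain ⟨R, hR, hNR⟩ := hN.exists_rotation hX hconf h1 hN₀.2
  refine ⟨R, hR, hNR, fun Q hQ => ?_⟩
  -- The rotated frame has the torsion of `N`, and every `Q` yields a competitor, so minimality over
  -- frames gives minimality over rotations.
  rw [← totalTorsion_congr hk hX hconf hN (hR.isWeakNormalFrame_rotate hX hconf h1 hN₀.2) hNR]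
  exact hT _ (hQ.isWeakNormalFrame_rotate hX hconf h1 hN₀.2)
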